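/- Let $\mathbb D\subset\mathbb C$ be the open unit disc and let $H^\infty(\mathbb D^2)$ be the Banach algebra of bounded holomorphic functions on $\mathbb D^2$ with the supremum norm $\|\cdot\|_\infty$. For a pair $M=(M^1,M^2)$ of commuting complex $m\times m$ matrices ($m\ge 1$), the joint spectrum $\sigma(M)$ is the set of all $(\lambda^1,\lambda^2)\in\mathbb C^2$ for which there is a nonzero $x\in\mathbb C^m$ with $M^ix=\lambda^ix$, $i=1,2$. If $\sigma(M)\subset\mathbb D^2$ and $\phi$ is holomorphic on $\mathbb D^2$, then $\phi(M)$ is defined by the Cauchy integral $$\phi(M)=\frac1{(2\pi i)^2}\int_{|\xi^1|=r}\int_{|\xi^2|=r}\phi(\xi^1,\xi^2)\,(\xi^1\,\mathrm{Id}-M^1)^{-1}(\xi^2\,\mathrm{Id}-M^2)^{-1}\,d\xi^2\,d\xi^1,$$ where $r<1$ is any radius with $|\lambda^1|,|\lambda^2|<r$ for all $(\lambda^1,\lambda^2)\in\sigma(M)$ (the value does not depend on $r$). Let $A=(A_n)_{n\in\mathbb N}$ be a sequence in which each $A_n$ is a pair of commuting complex $s_n\times s_n$ matrices with joint spectrum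 in $\mathbb D^2$; the sizes $s_n\ge1$ may vary with $n$ and need not be bounded. For $n\in\mathbb N$ and $\tau\subset\mathbb N\setminus\{n\}$ put $$\rho_G(A_n,A_\tau)=\frac1{\inf\{\|\phi\|_\infty : \phi\in H^\infty(\mathbb D^2),\ \phi(A_n)=\mathrm{Id},\ \phi(A_j)=0\ \text{for all } j\in\tau\}},$$ with $\rho_G(A_n,A_\tau)=0$ if there is no such $\phi$. If $$\prod_{n\in\mathbb N}\rho_G\bigl(A_n,A_{\mathbb N\setminus\{n\}}\bigr)>0,$$ then $A$ is interpolating for $H^\infty(\mathbb D^2)$: for every sequence $(\phi_n)_{n\in\mathbb N}$ in $H^\infty(\mathbb D^2)$ with $\sup_n\|\phi_n\|_\infty<\infty$ there is $\phi\in H^\infty(\mathbb D^2)$ such that $\phi(A_n)=\phi_n(A_n)$ for every $n\in\mathbb N$. -/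

import Mathlib

open Filter Topology
open scoped ENNReal

noncomputable section

namespace BidiscMatrix

/-- The bidisc `𝔻²`. -/
def bidisc : Set (ℂ × ℂ) := Metric.ball (0 : ℂ) 1 ×ˢ Metric.ball (0 : ℂ) 1

/-- The space `H^∞(𝔻²)` of bounded holomorphic functions on the bidisc. The values that a
function takes outside the bidisc are irrelevant and never used. -/
def Hinf : Set (ℂ × ℂ → ℂ) :=
  {φ | DifferentiableOn ℂ φ bidisc ∧ ∃ C : ℝ, ∀ z ∈ bidisc, ‖φ z‖ ≤ C}

/-- The supremum norm on the bidisc, with values in `[0, ∞]`. -/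
def supNorm (φ : ℂ × ℂ → ℂ) : ℝ≥0∞ := ⨆ z ∈ bidisc, ‖φ z‖ₑ

/-- Pairs of complex matrices of size `m`. -/
abbrev MatPair (m : ℕ) : Type := Matrix (Fin m) (Fin m) ℂ × Matrix (Fin m) (Fin m) ℂ

/-- The joint spectrum of a pair of commuting matrices: the set of its joint eigenvalues. -/
def jointSpectrum {m : ℕ} (M : MatPair m) : Set (ℂ × ℂ) :=
  {l | ∃ x : Fin m → ℂ, x ≠ 0 ∧ M.1.mulVec x = l.1 • x ∧ M.2.mulVec x = l.2 • x}

/-- The Cauchy integral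
`(2πi)⁻² ∫∫ φ(ξ₁, ξ₂) (ξ₁ - M₁)⁻¹ (ξ₂ - M₂)⁻¹ dξ₁ dξ₂`, taken entry by entry over the torus
`|ξ₁| = |ξ₂| = r`. -/
def cauchyEval (r : ℝ) (φ : ℂ × ℂ → ℂ) {m : ℕ} (M : MatPair m) : Matrix (Fin m) (Fin m) ℂ :=
  Matrix.of fun a b =>
    (1 / (2 * (Real.pi : ℂ) * Complex.I) ^ 2) *
      ∮ ξ₁ in C(0, r), ∮ ξ₂ in C(0, r),
        φ (ξ₁, ξ₂) *
          ((ξ₁ • (1 : Matrix (Fin m) (Fin m) ℂ) - M.1)⁻¹ *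
            (ξ₂ • (1 : Matrix (Fin m) (Fin m) ℂ) - M.2)⁻¹) a b

/-- A radius that lies strictly between the largest modulus of a coordinate of a point of the
joint spectrum and `1`, when the joint spectrum lies in the bidisc. -/
def evalRadius {m : ℕ} (M : MatPair m) : ℝ :=
  (1 + sSup ((fun l : ℂ × ℂ => max ‖l.1‖ ‖l.2‖) '' jointSpectrum M)) / 2

/-- The value `φ(M)` of a holomorphic function on the bidisc at a pair of commuting matrices
with joint spectrum in the bidisc. A function in `H^∞(𝔻²)` need not be defined on the unit
torus, so the Cauchy integral is taken over a torus inside the bidisc that surrounds the joint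
spectrum; by Cauchy's theorem its value does not depend on the radius of that torus. -/
def eval (φ : ℂ × ℂ → ℂ) {m : ℕ} (M : MatPair m) : Matrix (Fin m) (Fin m) ℂ :=
  cauchyEval (evalRadius M) φ M

/-- The Gleason distance `ρ_G(A_n, A_τ)` of `A_n` to the subfamily `(A_j)_{j ∈ τ}`: the inverse of
the infimum of the norms of the functions in `H^∞(𝔻²)` that are the identity at `A_n` and vanish
at every `A_j`, `j ∈ τ`. It is `0` when there is no such function. -/
def gleasonDist {s : ℕ → ℕ} (A : ∀ n, MatPair (s n)) (n : ℕ) (τ : Set ℕ) : ℝ≥0∞ :=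
  (⨅ φ ∈ {φ : ℂ × ℂ → ℂ | φ ∈ Hinf ∧ eval φ (A n) = 1 ∧ ∀ j ∈ τ, eval φ (A j) = 0},
    supNorm φ)⁻¹

/-- `A` is interpolating for `H^∞(𝔻²)`: for every bounded sequence `(φ_n)` in `H^∞(𝔻²)` there is
`φ` in `H^∞(𝔻²)` with `φ(A_n) = φ_n(A_n)` for every `n`. -/
def IsInterpolating {s : ℕ → ℕ} (A : ∀ n, MatPair (s n)) : Prop :=
  ∀ ψ : ℕ → ℂ × ℂ → ℂ, (∀ n, ψ n ∈ Hinf) →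
    (∃ C : ℝ, ∀ n, ∀ z ∈ bidisc, ‖ψ n z‖ ≤ C) →
    ∃ φ ∈ Hinf, ∀ n, eval φ (A n) = eval (ψ n) (A n)

end BidiscMatrix

end

open MeasureTheory Metric

/-! Positivity of the product gives functions `f n` with `‖f n‖ ≤ 1 - ε n`, `f n (A n) = (1 - ε n)²
Id`, `f n (A j) = 0` for `j ≠ n`, where `∑ ε n < ∞` and `1 - ε n` is bounded below: scale
near-extremal functions for the Gleason distances.

Two functions on the disc are composed with `f n`: `bump (ε n)`, which vanishes at 0, and `damp (ε
n)`, the exponential of minus a function with positive real part. They satisfy `|bump| |damp| ≤ 1 -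
|damp|` on `‖w‖ ≤ 1 - ε n`. Put `b n = bump (f n) * ∏_{k ≤ n} damp (f k)`. The inequality telescopes
to `∑ |b n| ≤ 1` on the bidisc (`sum_norm_bump_mul_dampProd_le`). Moreover `b n (A j) = 0` for `j ≠
n`, and `b n (A n) = κ n Id` with `|κ n|` bounded below, because `∑ ε k < ∞`. Hence `φ = ∑ (κ n)⁻¹ b
n ψ n` interpolates. Matrix sizes never enter the estimates.

The rest is functional calculus: `φ ↦ φ(M)` is multiplicative (`Encircles.cauchyEval_mul`),
compatible with composition when `f(M)` is scalar (`Encircles.cauchyEval_comp`), and continuous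
under bounded pointwise convergence on the torus (`Encircles.tendsto_cauchyEval`). -/

namespace BidiscMatrix

/-! ### Cauchy's formula on the bidisc and polynomial approximation -/

/-- The measure on pairs of angles that parametrizes the tori `|z₁| = |z₂| = R`. -/
noncomputable def angles : Measure (ℝ × ℝ) :=
  (volume.restrict (Set.Ioc 0 (2 * Real.pi))).prod (volume.restrict (Set.Ioc 0 (2 * Real.pi)))

/-- The point of the torus of radius `R` with the given angles. -/
noncomputable def torusPt (R : ℝ) (p : ℝ × ℝ) : ℂ × ℂ := (circleMap 0 R p.1, circleMap 0 R p.2)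

/-- The torus `|z₁| = |z₂| = R`. -/
def torus (R : ℝ) : Set (ℂ × ℂ) := sphere 0 R ×ˢ sphere 0 R

instance : IsFiniteMeasure angles := by unfold angles; infer_instance

theorem continuous_torusPt (R : ℝ) : Continuous (torusPt R) := by
  unfold torusPt; fun_prop

theorem torusPt_mem {R : ℝ} (hR : 0 ≤ R) (p : ℝ × ℝ) : torusPt R p ∈ torus R := by
  simp [torusPt, torus, abs_of_nonneg hR]

theorem norm_torusPt_fst {R : ℝ} (hR : 0 ≤ R) (p : ℝ × ℝ) : ‖(torusPt R p).1‖ = R := by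
  simpa [torus] using (torusPt_mem hR p).1

theorem norm_torusPt_snd {R : ℝ} (hR : 0 ≤ R) (p : ℝ × ℝ) : ‖(torusPt R p).2‖ = R := by
  simpa [torus] using (torusPt_mem hR p).2

theorem torus_subset_bidisc {R : ℝ} (hR : R < 1) : torus R ⊆ bidisc := by
  rintro ⟨z, w⟩ ⟨hz, hw⟩
  simp_all [bidisc]

theorem isOpen_bidisc : IsOpen bidisc := isOpen_ball.prod isOpen_ball

theorem continuous_comp_torusPt {E : Type*} [TopologicalSpace E] {u : ℂ × ℂ → E} {R : ℝ}
    (hR : 0 ≤ R) (hu : ContinuousOn u (torus R)) : Continuous fun p => u (torusPt R p) :=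
  hu.comp_continuous (continuous_torusPt R) (torusPt_mem hR)

theorem integrable_angles {u : ℝ × ℝ → ℂ} (hu : Continuous u) : Integrable u angles := by
  have h : IntegrableOn u (Set.Icc 0 (2 * Real.pi) ×ˢ Set.Icc 0 (2 * Real.pi)) :=
    hu.continuousOn.integrableOn_compact (isCompact_Icc.prod isCompact_Icc)
  rw [angles, Measure.prod_restrict]
  exact h.mono_set (Set.prod_mono Set.Ioc_subset_Icc_self Set.Ioc_subset_Icc_self)

/-- A single integral against a finite measure gives direct access to Fubini and dominated
convergence. The minus sign is `I²` from the two derivatives of `circleMap`. -/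
theorem circleIntegral_circleIntegral {R : ℝ} (hR : 0 ≤ R) {u : ℂ × ℂ → ℂ}
    (hu : ContinuousOn u (torus R)) :
    (∮ z in C(0, R), ∮ w in C(0, R), u (z, w)) =
      ∫ p, -((torusPt R p).1 * (torusPt R p).2) * u (torusPt R p) ∂angles := by
  have hc := continuous_comp_torusPt hR hu
  have ht := continuous_torusPt R
  have hπ := Real.two_pi_pos.le
  rw [angles, integral_prod (fun p => -((torusPt R p).1 * (torusPt R p).2) * u (torusPt R p))
    (integrable_angles (Continuous.mul (by fun_prop) hc))]
  simp only [circleIntegral, intervalIntegral.integral_of_le hπ]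
  congr 1
  ext θ
  rw [← integral_smul]
  congr 1
  ext η
  simp only [deriv_circleMap, smul_eq_mul, torusPt]
  linear_combination (circleMap 0 R θ) * (circleMap 0 R η) * u (circleMap 0 R θ, circleMap 0 R η) *
    Complex.I_mul_I

/-- The normalized Cauchy kernel of the disc. -/
noncomputable def cauchyKer (ξ z : ℂ) : ℂ := ξ / (ξ - z)

theorem circle_cauchy {R : ℝ} {f : ℂ → ℂ} (hf : DifferentiableOn ℂ f (closedBall 0 R))
    {z : ℂ} (hz : ‖z‖ < R) :
    (∮ ξ in C(0, R), (ξ - z)⁻¹ * f ξ) = 2 * Real.pi * Complex.I * f z := by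
  simpa using hf.circleIntegral_sub_inv_smul (w := z) (by simpa using hz)

theorem sub_ne_zero_of_norm_lt {ξ z : ℂ} (h : ‖z‖ < ‖ξ‖) : ξ - z ≠ 0 := by
  intro h'
  rw [sub_eq_zero.mp h'] at h
  exact lt_irrefl _ h

/-- The Cauchy integral formula on the bidisc. -/
theorem cauchy_formula {φ : ℂ × ℂ → ℂ} (hφ : DifferentiableOn ℂ φ bidisc) {R : ℝ} (hR : 0 < R)
    (hR1 : R < 1) {z : ℂ × ℂ} (hz1 : ‖z.1‖ < R) (hz2 : ‖z.2‖ < R) :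
    φ z = ∫ p, (4 * (Real.pi : ℂ) ^ 2)⁻¹ * (φ (torusPt R p) *
      (cauchyKer (torusPt R p).1 z.1 * cauchyKer (torusPt R p).2 z.2)) ∂angles := by
  have hmem : ∀ a b : ℂ, ‖a‖ ≤ R → ‖b‖ ≤ R → (a, b) ∈ bidisc := fun a b ha hb =>
    ⟨by simpa using ha.trans_lt hR1, by simpa using hb.trans_lt hR1⟩
  have h2 : ∀ ξ ∈ sphere (0 : ℂ) R,
      (∮ η in C(0, R), (ξ - z.1)⁻¹ * (η - z.2)⁻¹ * φ (ξ, η)) =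
        2 * Real.pi * Complex.I * ((ξ - z.1)⁻¹ * φ (ξ, z.2)) := by
    intro ξ hξ
    simp only [mul_assoc]
    rw [circleIntegral.integral_const_mul,
      circle_cauchy (f := fun η => φ (ξ, η)) (fun η hη => ?_) hz2]
    · ring
    · have : DifferentiableAt ℂ φ (ξ, η) :=
        hφ.differentiableAt (isOpen_bidisc.mem_nhds (hmem _ _ (by simpa using hξ.le)
          (by simpa using hη)))
      exact (this.comp (f := fun η => (ξ, η)) η (by fun_prop)).differentiableWithinAt
  have h1 : (∮ ξ in C(0, R), ∮ η in C(0, R), (ξ - z.1)⁻¹ * (η - z.2)⁻¹ * φ (ξ, η)) =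
      (2 * Real.pi * Complex.I) ^ 2 * φ z := by
    rw [circleIntegral.integral_congr hR.le h2, circleIntegral.integral_const_mul,
      circle_cauchy (f := fun ξ => φ (ξ, z.2)) (fun ξ hξ => ?_) hz1]
    · ring
    · have : DifferentiableAt ℂ φ (ξ, z.2) :=
        hφ.differentiableAt (isOpen_bidisc.mem_nhds (hmem _ _ (by simpa using hξ) hz2.le))
      exact (this.comp (f := fun ξ => (ξ, z.2)) ξ (by fun_prop)).differentiableWithinAt
  have hcont : ContinuousOn (fun q : ℂ × ℂ => (q.1 - z.1)⁻¹ * (q.2 - z.2)⁻¹ * φ q) (torus R) := by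
    refine ContinuousOn.mul (ContinuousOn.mul ?_ ?_)
      (hφ.continuousOn.mono (torus_subset_bidisc hR1))
    · refine ContinuousOn.inv₀ (by fun_prop) fun q hq => sub_ne_zero_of_norm_lt ?_
      have : ‖q.1‖ = R := by simpa using hq.1
      rwa [this]
    · refine ContinuousOn.inv₀ (by fun_prop) fun q hq => sub_ne_zero_of_norm_lt ?_
      have : ‖q.2‖ = R := by simpa using hq.2
      rwa [this]
  rw [circleIntegral_circleIntegral hR.le hcont] at h1
  have hπ : (Real.pi : ℂ) ≠ 0 := by exact_mod_cast Real.pi_ne_zero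
  have h3 : (2 * Real.pi * Complex.I : ℂ) ^ 2 = -(4 * (Real.pi : ℂ) ^ 2) := by
    linear_combination 4 * (Real.pi : ℂ) ^ 2 * Complex.I_sq
  rw [integral_const_mul, eq_inv_mul_iff_mul_eq₀ (by simp [hπ])]
  rw [h3] at h1
  rw [← neg_eq_iff_eq_neg.mpr (h1.trans (neg_mul _ _)), ← integral_neg]
  congr 1
  ext p
  simp only [cauchyKer, div_eq_mul_inv]
  ring

theorem norm_cauchyKer_le {R ρ : ℝ} (h : ρ < R) {ξ z : ℂ} (hξ : ‖ξ‖ = R) (hz : ‖z‖ ≤ ρ) :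
    ‖cauchyKer ξ z‖ ≤ R / (R - ρ) := by
  rw [cauchyKer, norm_div, hξ]
  have hR : 0 ≤ R := hξ ▸ norm_nonneg ξ
  have := norm_sub_norm_le ξ z
  gcongr
  linarith

/-- The truncated Cauchy kernel. -/
noncomputable def truncKer (N : ℕ) (ξ z : ℂ) : ℂ := ∑ j ∈ Finset.range N, (z / ξ) ^ j

theorem cauchyKer_sub_truncKer (N : ℕ) {ξ z : ℂ} (h : ‖z‖ < ‖ξ‖) :
    cauchyKer ξ z - truncKer N ξ z = (z / ξ) ^ N * cauchyKer ξ z := by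
  have hξ : ξ ≠ 0 := norm_pos_iff.mp ((norm_nonneg z).trans_lt h)
  have h1 := sub_ne_zero_of_norm_lt h
  have h2 := mul_neg_geom_sum (z / ξ) N
  have h3 : cauchyKer ξ z * (1 - z / ξ) = 1 := by
    rw [cauchyKer]; field_simp
  have h4 : cauchyKer ξ z * (1 - (z / ξ) ^ N) = truncKer N ξ z := by
    rw [← h2, ← mul_assoc, h3, one_mul, truncKer]
  rw [← h4]; ring

theorem norm_ker_sub_le {R r : ℝ} (hr : 0 < r) (h : r < R) (N : ℕ) {ξ η z w : ℂ} (hξ : ‖ξ‖ = R)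
    (hη : ‖η‖ = R) (hz : ‖z‖ ≤ r) (hw : ‖w‖ ≤ r) :
    ‖cauchyKer ξ z * cauchyKer η w - truncKer N ξ z * truncKer N η w‖ ≤
      3 * (R / (R - r)) ^ 2 * (r / R) ^ N := by
  have hR : 0 < R := hr.trans h
  have key : ∀ ξ z : ℂ, ‖ξ‖ = R → ‖z‖ ≤ r → ‖cauchyKer ξ z - truncKer N ξ z‖ ≤
      (r / R) ^ N * (R / (R - r)) := by
    intro ξ z hξ hz
    rw [cauchyKer_sub_truncKer N (by linarith), norm_mul, norm_pow, norm_div, hξ]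
    have := norm_cauchyKer_le h hξ hz
    gcongr
  have hq : (r / R) ^ N ≤ 1 := pow_le_one₀ (by positivity) ((div_le_one hR).mpr h.le)
  have hD : 0 ≤ R / (R - r) := div_nonneg hR.le (by linarith)
  have h1 := key ξ z hξ hz
  have h2 := key η w hη hw
  have h3 := norm_cauchyKer_le h hξ hz
  have h4 := norm_cauchyKer_le h hη hw
  have h5 : ‖truncKer N ξ z‖ ≤ 2 * (R / (R - r)) := by
    have : truncKer N ξ z = cauchyKer ξ z - (cauchyKer ξ z - truncKer N ξ z) := by ring
    rw [this]
    refine (norm_sub_le _ _).trans ?_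
    nlinarith
  -- Of the constant 3 in the bound, this splitting contributes 1 from the first term and 2 from the
  -- bound on `truncKer` in the second.
  have : cauchyKer ξ z * cauchyKer η w - truncKer N ξ z * truncKer N η w =
      (cauchyKer ξ z - truncKer N ξ z) * cauchyKer η w +
        truncKer N ξ z * (cauchyKer η w - truncKer N η w) := by ring
  rw [this]
  calc _ ≤ ‖cauchyKer ξ z - truncKer N ξ z‖ * ‖cauchyKer η w‖ +
        ‖truncKer N ξ z‖ * ‖cauchyKer η w - truncKer N η w‖ := by
        refine (norm_add_le _ _).trans (le_of_eq ?_)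
        rw [norm_mul, norm_mul]
    _ ≤ ((r / R) ^ N * (R / (R - r))) * (R / (R - r)) +
        (2 * (R / (R - r))) * ((r / R) ^ N * (R / (R - r))) := by gcongr
    _ = _ := by ring

/-- The monomial `z₁ ^ j * z₂ ^ k`. -/
def monom (i : ℕ × ℕ) (z : ℂ × ℂ) : ℂ := z.1 ^ i.1 * z.2 ^ i.2

/-- A polynomial in two variables, given by its coefficients. -/
noncomputable def poly (s : Finset (ℕ × ℕ)) (a : ℕ × ℕ → ℂ) (z : ℂ × ℂ) : ℂ :=
  ∑ i ∈ s, a i * monom i z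

theorem differentiable_monom (i : ℕ × ℕ) : Differentiable ℂ (monom i) := by
  unfold monom; fun_prop

theorem differentiable_poly (s : Finset (ℕ × ℕ)) (a : ℕ × ℕ → ℂ) :
    Differentiable ℂ (poly s a) := by
  unfold poly monom; fun_prop

theorem exists_norm_le_torus {u : ℂ × ℂ → ℂ} {R : ℝ} (hu : ContinuousOn u (torus R)) :
    ∃ C, 0 ≤ C ∧ ∀ z ∈ torus R, ‖u z‖ ≤ C := by
  have hc : IsCompact (torus R) := (isCompact_sphere 0 R).prod (isCompact_sphere 0 R)
  obtain ⟨C, hC⟩ := hc.exists_bound_of_continuousOn hu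
  exact ⟨max C 0, le_max_right _ _, fun z hz => (hC z hz).trans (le_max_left _ _)⟩

/-- Holomorphic functions on the bidisc are uniform limits of polynomials on smaller tori. -/
theorem exists_poly_approx {φ : ℂ × ℂ → ℂ} (hφ : DifferentiableOn ℂ φ bidisc) {r : ℝ} (hr : 0 < r)
    (hr1 : r < 1) : ∃ (s : ℕ → Finset (ℕ × ℕ)) (a : ℕ → ℕ × ℕ → ℂ),
      TendstoUniformlyOn (fun N => poly (s N) (a N)) φ atTop (torus r) := by
  obtain ⟨R, hrR, hR1⟩ := exists_between hr1
  have hR : 0 < R := hr.trans hrR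
  obtain ⟨C, hC0, hC⟩ := exists_norm_le_torus (hφ.continuousOn.mono (torus_subset_bidisc hR1))
  have hcφ := continuous_comp_torusPt hR.le (hφ.continuousOn.mono (torus_subset_bidisc hR1))
  have hct := continuous_torusPt R
  have hn1 : ∀ p, (torusPt R p).1 ≠ 0 := fun p =>
    norm_pos_iff.mp (by rw [norm_torusPt_fst hR.le]; exact hR)
  have hn2 : ∀ p, (torusPt R p).2 ≠ 0 := fun p =>
    norm_pos_iff.mp (by rw [norm_torusPt_snd hR.le]; exact hR)
  set c : ℂ := (4 * (Real.pi : ℂ) ^ 2)⁻¹ with hc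
  -- The Taylor coefficients of `φ` at the origin, as Cauchy integrals over the larger torus of
  -- radius `R`; they do not depend on the degree of truncation.
  let a : ℕ × ℕ → ℂ := fun i =>
    ∫ p, c * (φ (torusPt R p) * (((torusPt R p).1 ^ i.1)⁻¹ * ((torusPt R p).2 ^ i.2)⁻¹)) ∂angles
  have hpoly : ∀ N z, poly (Finset.range N ×ˢ Finset.range N) a z =
      ∫ p, c * (φ (torusPt R p) *
        (truncKer N (torusPt R p).1 z.1 * truncKer N (torusPt R p).2 z.2)) ∂angles := by
    intro N z
    have hprod : ∀ ξ η : ℂ, truncKer N ξ z.1 * truncKer N η z.2 =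
        ∑ i ∈ Finset.range N ×ˢ Finset.range N, (z.1 / ξ) ^ i.1 * (z.2 / η) ^ i.2 := by
      intro ξ η
      rw [truncKer, truncKer, Finset.sum_mul_sum, ← Finset.sum_product']
    simp only [poly, a, hprod, Finset.mul_sum]
    rw [integral_finsetSum]
    · refine Finset.sum_congr rfl fun i _ => ?_
      rw [← integral_mul_const]
      congr 1
      ext p
      simp only [monom, div_eq_mul_inv]
      ring
    · intro i _
      refine integrable_angles ?_
      refine continuous_const.mul (hcφ.mul (Continuous.mul ?_ ?_))
      · exact (continuous_const.div hct.fst hn1).pow _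
      · exact (continuous_const.div hct.snd hn2).pow _
  refine ⟨fun N => Finset.range N ×ˢ Finset.range N, fun _ => a, ?_⟩
  set K : ℝ := ‖c‖ * (C * (3 * (R / (R - r)) ^ 2)) * angles.real Set.univ with hK
  have hlim : Tendsto (fun N : ℕ => K * (r / R) ^ N) atTop (𝓝 0) := by
    have := (tendsto_pow_atTop_nhds_zero_of_lt_one (r := r / R) (by positivity)
      ((div_lt_one hR).mpr hrR)).const_mul K
    simpa using this
  rw [Metric.tendstoUniformlyOn_iff]
  intro ε hε
  filter_upwards [(hlim.eventually (gt_mem_nhds hε))] with N hN z hz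
  have hz1 : ‖z.1‖ = r := by simpa using hz.1
  have hz2 : ‖z.2‖ = r := by simpa using hz.2
  refine lt_of_le_of_lt ?_ hN
  have hk : ∀ p, (torusPt R p).1 - z.1 ≠ 0 := fun p => sub_ne_zero_of_norm_lt (by
    rw [norm_torusPt_fst hR.le, hz1]; exact hrR)
  have hk' : ∀ p, (torusPt R p).2 - z.2 ≠ 0 := fun p => sub_ne_zero_of_norm_lt (by
    rw [norm_torusPt_snd hR.le, hz2]; exact hrR)
  rw [dist_eq_norm, hpoly, cauchy_formula hφ hR hR1 (hz1.trans_lt hrR) (hz2.trans_lt hrR),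
    ← integral_sub]
  · refine (norm_integral_le_of_norm_le_const (C := ‖c‖ * (C * (3 * (R / (R - r)) ^ 2 *
      (r / R) ^ N))) (Eventually.of_forall fun p => ?_)).trans (le_of_eq (by rw [hK]; ring))
    rw [← mul_sub, ← mul_sub, norm_mul, norm_mul]
    gcongr
    · exact hC _ (torusPt_mem hR.le p)
    · exact norm_ker_sub_le hr hrR N (norm_torusPt_fst hR.le p) (norm_torusPt_snd hR.le p)
        hz1.le hz2.le
  · refine integrable_angles ?_
    refine continuous_const.mul (hcφ.mul (Continuous.mul ?_ ?_))
    · exact hct.fst.div (hct.fst.sub continuous_const) hk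
    · exact hct.snd.div (hct.snd.sub continuous_const) hk'
  · refine integrable_angles ?_
    refine continuous_const.mul (hcφ.mul (Continuous.mul ?_ ?_))
    · exact continuous_finsetSum _ fun j _ => (continuous_const.div hct.fst hn1).pow _
    · exact continuous_finsetSum _ fun j _ => (continuous_const.div hct.snd hn2).pow _

/-! ### Joint spectrum and the radius of evaluation -/

/-- The torus of radius `r` lies inside the bidisc and surrounds the spectra of the two commuting
matrices of `M`. -/
structure Encircles (r : ℝ) {m : ℕ} (M : MatPair m) : Prop where
  pos : 0 < r
  lt_one : r < 1
  comm : Commute M.1 M.2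
  det_fst : ∀ ξ : ℂ, r ≤ ‖ξ‖ → (ξ • (1 : Matrix (Fin m) (Fin m) ℂ) - M.1).det ≠ 0
  det_snd : ∀ ξ : ℂ, r ≤ ‖ξ‖ → (ξ • (1 : Matrix (Fin m) (Fin m) ℂ) - M.2).det ≠ 0

section Spectrum

variable {m : ℕ}

/-- The eigenspace of `B` for `l` is invariant under `C`, so `C` has an eigenvector in it. Thus the
joint spectrum controls every eigenvalue of each single matrix, hence both resolvents. -/
theorem exists_joint_eigenvector {B C : Matrix (Fin m) (Fin m) ℂ} (h : Commute B C) {l : ℂ}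
    (hl : (l • (1 : Matrix (Fin m) (Fin m) ℂ) - B).det = 0) :
    ∃ μ : ℂ, ∃ x : Fin m → ℂ, x ≠ 0 ∧ B.mulVec x = l • x ∧ C.mulVec x = μ • x := by
  obtain ⟨v, hv, hv0⟩ := Matrix.exists_mulVec_eq_zero_iff.mpr hl
  have hBv : B.mulVec v = l • v := by
    rw [Matrix.sub_mulVec, Matrix.smul_mulVec, Matrix.one_mulVec, sub_eq_zero] at hv0
    exact hv0.symm
  let W : Submodule ℂ (Fin m → ℂ) := Module.End.eigenspace B.mulVecLin l
  have hW : ∀ x, x ∈ W ↔ B.mulVec x = l • x := fun x => by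
    simp [W]
  have hC : ∀ x ∈ W, C.mulVecLin x ∈ W := by
    intro x hx
    rw [hW] at hx ⊢
    rw [Matrix.mulVecLin_apply, Matrix.mulVec_mulVec, h.eq, ← Matrix.mulVec_mulVec, hx,
      Matrix.mulVec_smul]
  have : Nontrivial W := ⟨⟨⟨v, (hW v).mpr hBv⟩, 0, fun h' => hv (congrArg Subtype.val h')⟩⟩
  obtain ⟨μ, hμ⟩ := Module.End.exists_eigenvalue (C.mulVecLin.restrict hC)
  obtain ⟨x, hx⟩ := hμ.exists_hasEigenvector
  refine ⟨μ, x, fun h' => hx.2 (Subtype.ext h'), (hW _).mp x.2, ?_⟩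
  have := congrArg Subtype.val hx.apply_eq_smul
  simpa using this

theorem finite_det_eq_zero (B : Matrix (Fin m) (Fin m) ℂ) :
    {l : ℂ | (l • (1 : Matrix (Fin m) (Fin m) ℂ) - B).det = 0}.Finite := by
  refine (Polynomial.finite_setOfPred_isRoot (Matrix.charpoly_monic B).ne_zero).subset fun l hl => ?_
  simp only [Set.mem_ofPred_eq, Polynomial.IsRoot, Matrix.eval_charpoly] at hl ⊢
  rwa [Matrix.smul_one_eq_diagonal] at hl

theorem det_eq_zero_of_mulVec {B : Matrix (Fin m) (Fin m) ℂ} {l : ℂ} {x : Fin m → ℂ} (hx : x ≠ 0)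
    (h : B.mulVec x = l • x) : (l • (1 : Matrix (Fin m) (Fin m) ℂ) - B).det = 0 :=
  Matrix.exists_mulVec_eq_zero_iff.mp ⟨x, hx, by
    rw [Matrix.sub_mulVec, Matrix.smul_mulVec, Matrix.one_mulVec, h, sub_self]⟩

theorem finite_jointSpectrum (M : MatPair m) : (jointSpectrum M).Finite := by
  refine ((finite_det_eq_zero M.1).prod (finite_det_eq_zero M.2)).subset ?_
  rintro l ⟨x, hx, h1, h2⟩
  exact ⟨det_eq_zero_of_mulVec hx h1, det_eq_zero_of_mulVec hx h2⟩

theorem encircles_evalRadius (hm : 0 < m) {M : MatPair m} (hcomm : Commute M.1 M.2)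
    (hspec : jointSpectrum M ⊆ bidisc) : Encircles (evalRadius M) M := by
  set S := (fun l : ℂ × ℂ => max ‖l.1‖ ‖l.2‖) '' jointSpectrum M with hS
  have hfin : S.Finite := (finite_jointSpectrum M).image _
  have : NeZero m := ⟨hm.ne'⟩
  have hne : S.Nonempty := by
    obtain ⟨l, hl⟩ := Module.End.exists_eigenvalue M.1.mulVecLin
    obtain ⟨x, hx⟩ := hl.exists_hasEigenvector
    obtain ⟨μ, y, hy⟩ := exists_joint_eigenvector hcomm
      (det_eq_zero_of_mulVec hx.2 (by simpa using hx.apply_eq_smul))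
    exact ⟨_, (l, μ), ⟨y, hy⟩, rfl⟩
  have hmem := hne.csSup_mem hfin
  have h01 : 0 ≤ sSup S ∧ sSup S < 1 := by
    obtain ⟨l, hl, h⟩ := hmem
    rw [← h]
    have := hspec hl
    simp only [bidisc, Set.mem_prod, mem_ball_zero_iff] at this
    exact ⟨le_max_of_le_left (norm_nonneg _), max_lt this.1 this.2⟩
  have hr : evalRadius M = (1 + sSup S) / 2 := rfl
  have hlt : ∀ l ∈ jointSpectrum M, ‖l.1‖ < evalRadius M ∧ ‖l.2‖ < evalRadius M := by
    intro l hl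
    have h1 : max ‖l.1‖ ‖l.2‖ ≤ sSup S := le_csSup hfin.bddAbove ⟨l, hl, rfl⟩
    have h2 := max_le_iff.mp h1
    rw [hr]
    constructor <;> linarith [h2.1, h2.2, h01.2]
  refine ⟨by rw [hr]; linarith, by rw [hr]; linarith, hcomm, fun ξ hξ h0 => ?_, fun ξ hξ h0 => ?_⟩
  · obtain ⟨μ, x, hx, h1, h2⟩ := exists_joint_eigenvector hcomm h0
    exact absurd (hlt (ξ, μ) ⟨x, hx, h1, h2⟩).1 (not_lt.mpr hξ)
  · obtain ⟨μ, x, hx, h1, h2⟩ := exists_joint_eigenvector hcomm.symm h0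
    exact absurd (hlt (μ, ξ) ⟨x, hx, h2, h1⟩).2 (not_lt.mpr hξ)

end Spectrum

/-! ### Contour integrals of resolvents -/

section Resolvent

variable {m : ℕ}

theorem differentiableAt_det {A : ℂ → Matrix (Fin m) (Fin m) ℂ} {z : ℂ}
    (hA : ∀ a b, DifferentiableAt ℂ (fun z => A z a b) z) :
    DifferentiableAt ℂ (fun z => (A z).det) z := by
  simp only [Matrix.det_apply]
  refine DifferentiableAt.fun_sum fun σ _ => DifferentiableAt.const_smul ?_ _
  exact DifferentiableAt.fun_finsetProd fun i _ => hA _ _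

theorem differentiableAt_inv {A : ℂ → Matrix (Fin m) (Fin m) ℂ} {z : ℂ}
    (hA : ∀ a b, DifferentiableAt ℂ (fun z => A z a b) z) (hdet : (A z).det ≠ 0) (a b : Fin m) :
    DifferentiableAt ℂ (fun z => (A z)⁻¹ a b) z := by
  -- Cramer's rule: entries of the adjugate are again determinants with holomorphic entries.
  simp only [Matrix.inv_def, Ring.inverse_eq_inv', Matrix.smul_apply, smul_eq_mul,
    Matrix.adjugate_apply]
  refine ((differentiableAt_det hA).inv hdet).mul (differentiableAt_det fun c d => ?_)
  by_cases hc : c = b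
  · subst hc
    simp
  · simpa [Matrix.updateRow_ne hc] using hA c d

theorem differentiableAt_resolvent {B : Matrix (Fin m) (Fin m) ℂ} {ξ : ℂ}
    (h : (ξ • (1 : Matrix (Fin m) (Fin m) ℂ) - B).det ≠ 0) (a b : Fin m) :
    DifferentiableAt ℂ (fun ξ => (ξ • (1 : Matrix (Fin m) (Fin m) ℂ) - B)⁻¹ a b) ξ := by
  refine differentiableAt_inv (fun c d => ?_) h a b
  simp only [Matrix.sub_apply, Matrix.smul_apply, smul_eq_mul]
  fun_prop

theorem inv_one_sub_smul {B : Matrix (Fin m) (Fin m) ℂ} {ξ : ℂ} (hξ : ξ ≠ 0)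
    (h : (ξ • (1 : Matrix (Fin m) (Fin m) ℂ) - B).det ≠ 0) :
    (1 - ξ⁻¹ • B)⁻¹ = ξ • (ξ • (1 : Matrix (Fin m) (Fin m) ℂ) - B)⁻¹ := by
  refine Matrix.inv_eq_left_inv ?_
  have : 1 - ξ⁻¹ • B = ξ⁻¹ • (ξ • (1 : Matrix (Fin m) (Fin m) ℂ) - B) := by
    rw [smul_sub, smul_smul, inv_mul_cancel₀ hξ, one_smul]
  rw [this, smul_mul_smul_comm, mul_inv_cancel₀ hξ, one_smul, Matrix.nonsing_inv_mul]
  exact isUnit_iff_ne_zero.mpr h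

/-- The substitution `ξ = r / z` moves the exterior of the circle to the unit disc, where `(1 - (z /
r) B)⁻¹` is holomorphic with value `Id` at 0; the mean value property then gives the integral. -/
theorem circleIntegral_resolvent {B : Matrix (Fin m) (Fin m) ℂ} {r : ℝ} (hr : 0 < r)
    (h : ∀ ξ : ℂ, r ≤ ‖ξ‖ → (ξ • (1 : Matrix (Fin m) (Fin m) ℂ) - B).det ≠ 0) (a b : Fin m) :
    (∮ ξ in C(0, r), (ξ • (1 : Matrix (Fin m) (Fin m) ℂ) - B)⁻¹ a b) =
      2 * Real.pi * Complex.I * (1 : Matrix (Fin m) (Fin m) ℂ) a b := by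
  have hrC : (r : ℂ) ≠ 0 := by exact_mod_cast hr.ne'
  let H : ℂ → ℂ := fun z => (1 - (z / r) • B)⁻¹ a b
  have hdet : ∀ z : ℂ, ‖z‖ ≤ 1 → (1 - (z / r) • B).det ≠ 0 := by
    intro z hz
    by_cases hz0 : z = 0
    · simp [hz0]
    · have h1 : r ≤ ‖(r : ℂ) / z‖ := by
        rw [norm_div, Complex.norm_real, Real.norm_of_nonneg hr.le]
        exact le_div_self hr.le (norm_pos_iff.mpr hz0) hz
      have h2 : 1 - (z / r) • B =
          (z / r) • (((r : ℂ) / z) • (1 : Matrix (Fin m) (Fin m) ℂ) - B) := by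
        rw [smul_sub, smul_smul, div_mul_div_cancel₀ hrC, div_self hz0, one_smul]
      rw [h2, Matrix.det_smul]
      exact mul_ne_zero (pow_ne_zero _ (div_ne_zero hz0 hrC)) (h _ h1)
  have hH : DifferentiableOn ℂ H (closedBall 0 1) := fun z hz => by
    refine (differentiableAt_inv (fun c d => ?_)
      (hdet z (by simpa using hz)) a b).differentiableWithinAt
    simp only [Matrix.sub_apply, Matrix.smul_apply, smul_eq_mul]
    fun_prop
  have havg : Real.circleAverage H 0 1 = H 0 := by
    refine DiffContOnCl.circleAverage (DifferentiableOn.diffContOnCl (hH.mono ?_))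
    rw [abs_one]
    exact closure_ball_subset_closedBall
  rw [← Real.circleAverage_zero_one_congr_inv, Real.circleAverage] at havg
  have h0 : H 0 = (1 : Matrix (Fin m) (Fin m) ℂ) a b := by simp [H]
  have hint : ∀ θ : ℝ, deriv (circleMap 0 r) θ •
      (circleMap 0 r θ • (1 : Matrix (Fin m) (Fin m) ℂ) - B)⁻¹ a b =
      Complex.I * H (circleMap 0 1 θ)⁻¹ := by
    intro θ
    have hne : circleMap 0 r θ ≠ 0 := circleMap_ne_center hr.ne'
    have h1 : (circleMap 0 1 θ)⁻¹ / (r : ℂ) = (circleMap 0 r θ)⁻¹ := by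
      simp [circleMap, div_eq_mul_inv, mul_comm]
    simp only [H]
    rw [h1, inv_one_sub_smul hne (h _ (by simp [abs_of_pos hr]))]
    simp only [deriv_circleMap, smul_eq_mul, Matrix.smul_apply]
    ring
  rw [h0] at havg
  simp only [circleIntegral, hint]
  rw [intervalIntegral.integral_const_mul, ← havg, Complex.real_smul]
  have hπ : (Real.pi : ℂ) ≠ 0 := by exact_mod_cast Real.pi_ne_zero
  push_cast
  field_simp

theorem circleIntegral_pow_resolvent {B : Matrix (Fin m) (Fin m) ℂ} {r : ℝ} (hr : 0 < r)
    (h : ∀ ξ : ℂ, r ≤ ‖ξ‖ → (ξ • (1 : Matrix (Fin m) (Fin m) ℂ) - B).det ≠ 0) (j : ℕ)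
    (a b : Fin m) :
    (∮ ξ in C(0, r), ξ ^ j * (ξ • (1 : Matrix (Fin m) (Fin m) ℂ) - B)⁻¹ a b) =
      2 * Real.pi * Complex.I * (B ^ j) a b := by
  have hci : ∀ (j : ℕ) (c d : Fin m), CircleIntegrable
      (fun ξ => ξ ^ j * (ξ • (1 : Matrix (Fin m) (Fin m) ℂ) - B)⁻¹ c d) 0 r := fun j c d =>
    ContinuousOn.circleIntegrable hr.le fun ξ hξ => by
      have hξ : ‖ξ‖ = r := by simpa using hξ
      exact ((continuousAt_id.pow j).mul
        (differentiableAt_resolvent (h ξ hξ.ge) c d).continuousAt).continuousWithinAt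
  induction j generalizing a b with
  | zero => simpa using circleIntegral_resolvent hr h a b
  | succ j ih =>
    have hcongr : Set.EqOn
        (fun ξ => ξ ^ (j + 1) * (ξ • (1 : Matrix (Fin m) (Fin m) ℂ) - B)⁻¹ a b)
        (fun ξ => ξ ^ j * (1 : Matrix (Fin m) (Fin m) ℂ) a b + ∑ c, B a c *
          (ξ ^ j * (ξ • (1 : Matrix (Fin m) (Fin m) ℂ) - B)⁻¹ c b)) (sphere 0 r) := by
      intro ξ hξ
      have hξ : ‖ξ‖ = r := by simpa using hξ
      -- The recursion is `ξ (ξ - B)⁻¹ = Id + B (ξ - B)⁻¹`; the `ξ ^ j Id` term integrates to zero.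
      have h1 : (ξ • (1 : Matrix (Fin m) (Fin m) ℂ) - B) *
          (ξ • (1 : Matrix (Fin m) (Fin m) ℂ) - B)⁻¹ = 1 :=
        Matrix.mul_nonsing_inv _ (isUnit_iff_ne_zero.mpr (h ξ hξ.ge))
      rw [sub_mul, smul_mul_assoc, one_mul, sub_eq_iff_eq_add] at h1
      have h2 := congrFun (congrFun h1 a) b
      simp only [Matrix.smul_apply, smul_eq_mul, Matrix.add_apply, Matrix.mul_apply] at h2
      simp only
      rw [pow_succ, mul_assoc, h2, mul_add, Finset.mul_sum]
      congr 1
      exact Finset.sum_congr rfl fun c _ => by ring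
    have hz : (∮ ξ in C(0, r), ξ ^ j * (1 : Matrix (Fin m) (Fin m) ℂ) a b) = 0 :=
      Complex.circleIntegral_eq_zero_of_differentiable_on_off_countable hr.le Set.countable_empty
        (by fun_prop) (fun z _ => by fun_prop)
    rw [circleIntegral.integral_congr hr.le hcongr, circleIntegral.integral_add, hz, zero_add,
      circleIntegral.integral_fun_sum]
    · simp only [circleIntegral.integral_const_mul, ih]
      rw [pow_succ', Matrix.mul_apply, Finset.mul_sum]
      exact Finset.sum_congr rfl fun c _ => by ring
    · exact fun c _ => (hci j c b).const_fun_smul (a := B a c)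
    · exact ContinuousOn.circleIntegrable hr.le (by fun_prop)
    · exact CircleIntegrable.fun_sum _ fun c _ => (hci j c b).const_fun_smul (a := B a c)

end Resolvent

/-! ### The Cauchy functional calculus for a commuting pair -/

section Calculus

variable {m : ℕ} {r : ℝ} {M : MatPair m}

/-- The density, on the torus, of the functional `φ ↦ φ(M) a b`. -/
noncomputable def evalKer (M : MatPair m) (a b : Fin m) (z : ℂ × ℂ) : ℂ :=
  (1 / (2 * (Real.pi : ℂ) * Complex.I) ^ 2) * (-(z.1 * z.2) *
    ((z.1 • (1 : Matrix (Fin m) (Fin m) ℂ) - M.1)⁻¹ *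
      (z.2 • (1 : Matrix (Fin m) (Fin m) ℂ) - M.2)⁻¹) a b)

theorem Encircles.continuousOn_resolvent_mul (h : Encircles r M) (a b : Fin m) :
    ContinuousOn (fun z : ℂ × ℂ => ((z.1 • (1 : Matrix (Fin m) (Fin m) ℂ) - M.1)⁻¹ *
      (z.2 • (1 : Matrix (Fin m) (Fin m) ℂ) - M.2)⁻¹) a b) (torus r) := by
  intro z hz
  have h1 : ‖z.1‖ = r := by simpa using hz.1
  have h2 : ‖z.2‖ = r := by simpa using hz.2
  simp only [Matrix.mul_apply]
  refine ContinuousAt.continuousWithinAt (tendsto_finsetSum _ fun c _ => ?_)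
  exact ContinuousAt.mul
    ((differentiableAt_resolvent (h.det_fst _ h1.ge) a c).continuousAt.comp continuousAt_fst)
    ((differentiableAt_resolvent (h.det_snd _ h2.ge) c b).continuousAt.comp continuousAt_snd)

theorem Encircles.continuousOn_evalKer (h : Encircles r M) (a b : Fin m) :
    ContinuousOn (evalKer M a b) (torus r) :=
  continuousOn_const.mul (ContinuousOn.mul (by fun_prop) (h.continuousOn_resolvent_mul a b))

theorem Encircles.cauchyEval_apply (h : Encircles r M) {φ : ℂ × ℂ → ℂ}
    (hφ : ContinuousOn φ (torus r)) (a b : Fin m) :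
    cauchyEval r φ M a b = ∫ p, φ (torusPt r p) * evalKer M a b (torusPt r p) ∂angles := by
  rw [cauchyEval, Matrix.of_apply, circleIntegral_circleIntegral h.pos.le
    (u := fun z => φ z * ((z.1 • (1 : Matrix (Fin m) (Fin m) ℂ) - M.1)⁻¹ *
      (z.2 • (1 : Matrix (Fin m) (Fin m) ℂ) - M.2)⁻¹) a b)
    (hφ.mul (h.continuousOn_resolvent_mul a b)), ← integral_const_mul]
  congr 1
  ext p
  rw [evalKer]
  ring

theorem Encircles.continuous_integrand (h : Encircles r M) {φ : ℂ × ℂ → ℂ}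
    (hφ : ContinuousOn φ (torus r)) (a b : Fin m) :
    Continuous fun p => φ (torusPt r p) * evalKer M a b (torusPt r p) :=
  (continuous_comp_torusPt h.pos.le hφ).mul
    (continuous_comp_torusPt h.pos.le (h.continuousOn_evalKer a b))

theorem Encircles.continuousOn (h : Encircles r M) {φ : ℂ × ℂ → ℂ}
    (hφ : DifferentiableOn ℂ φ bidisc) : ContinuousOn φ (torus r) :=
  hφ.continuousOn.mono (torus_subset_bidisc h.lt_one)

theorem Encircles.cauchyEval_sum (h : Encircles r M) {ι : Type*} (s : Finset ι) (c : ι → ℂ)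
    {φ : ι → ℂ × ℂ → ℂ} (hφ : ∀ i ∈ s, ContinuousOn (φ i) (torus r)) :
    cauchyEval r (fun z => ∑ i ∈ s, c i * φ i z) M = ∑ i ∈ s, c i • cauchyEval r (φ i) M := by
  have hc : ContinuousOn (fun z => ∑ i ∈ s, c i * φ i z) (torus r) :=
    continuousOn_finsetSum _ fun i hi => continuousOn_const.mul (hφ i hi)
  ext a b
  rw [h.cauchyEval_apply hc, Matrix.sum_apply]
  simp only [Finset.sum_mul]
  rw [integral_finsetSum]
  · refine Finset.sum_congr rfl fun i hi => ?_
    rw [Matrix.smul_apply, h.cauchyEval_apply (hφ i hi), smul_eq_mul, ← integral_const_mul]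
    simp only [mul_assoc]
  · intro i hi
    exact integrable_angles
      (h.continuous_integrand (continuousOn_const.mul (hφ i hi)) a b)

theorem Encircles.cauchyEval_add (h : Encircles r M) {φ ψ : ℂ × ℂ → ℂ}
    (hφ : ContinuousOn φ (torus r)) (hψ : ContinuousOn ψ (torus r)) :
    cauchyEval r (fun z => φ z + ψ z) M = cauchyEval r φ M + cauchyEval r ψ M := by
  have := h.cauchyEval_sum Finset.univ (fun _ : Fin 2 => 1) (φ := ![φ, ψ])
    (by intro i _; fin_cases i <;> simpa)
  simpa [Fin.sum_univ_two] using this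

theorem Encircles.cauchyEval_const_mul (h : Encircles r M) (c : ℂ) {φ : ℂ × ℂ → ℂ}
    (hφ : ContinuousOn φ (torus r)) :
    cauchyEval r (fun z => c * φ z) M = c • cauchyEval r φ M := by
  simpa using h.cauchyEval_sum (Finset.univ : Finset Unit) (fun _ => c) (φ := fun _ => φ)
    (fun _ _ => hφ)

/-- Dominated convergence against the bounded kernel `evalKer`. It serves polynomial approximation,
powers of a function of norm below 1, and partial sums of series. -/
theorem Encircles.tendsto_cauchyEval (h : Encircles r M) {φ : ℕ → ℂ × ℂ → ℂ} {ψ : ℂ × ℂ → ℂ}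
    {C : ℝ} (hφ : ∀ n, ContinuousOn (φ n) (torus r)) (hψ : ContinuousOn ψ (torus r))
    (hC : ∀ᶠ n in atTop, ∀ z ∈ torus r, ‖φ n z‖ ≤ C)
    (hlim : ∀ z ∈ torus r, Tendsto (fun n => φ n z) atTop (𝓝 (ψ z))) :
    Tendsto (fun n => cauchyEval r (φ n) M) atTop (𝓝 (cauchyEval r ψ M)) := by
  refine tendsto_pi_nhds.mpr fun a => tendsto_pi_nhds.mpr fun b => ?_
  rw [h.cauchyEval_apply hψ]
  simp only [h.cauchyEval_apply (hφ _)]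
  obtain ⟨K, hK0, hK⟩ := exists_norm_le_torus (h.continuousOn_evalKer a b)
  refine tendsto_integral_filter_of_dominated_convergence (fun _ => C * K) ?_ ?_
    (integrable_const _) ?_
  · exact Eventually.of_forall fun n =>
      (integrable_angles (h.continuous_integrand (hφ n) a b)).aestronglyMeasurable
  · filter_upwards [hC] with n hn
    refine Eventually.of_forall fun p => ?_
    have hp := torusPt_mem h.pos.le p
    rw [norm_mul]
    exact mul_le_mul (hn _ hp) (hK _ hp) (norm_nonneg _) ((norm_nonneg _).trans (hn _ hp))
  · exact Eventually.of_forall fun p => (hlim _ (torusPt_mem h.pos.le p)).mul_const _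

theorem Encircles.cauchyEval_monom (h : Encircles r M) (i : ℕ × ℕ) :
    cauchyEval r (monom i) M = M.1 ^ i.1 * M.2 ^ i.2 := by
  ext a b
  have hinner : Set.EqOn (fun ξ : ℂ => ∮ η in C(0, r), monom i (ξ, η) *
      ((ξ • (1 : Matrix (Fin m) (Fin m) ℂ) - M.1)⁻¹ *
        (η • (1 : Matrix (Fin m) (Fin m) ℂ) - M.2)⁻¹) a b)
      (fun ξ => ∑ c, (2 * Real.pi * Complex.I * (M.2 ^ i.2) c b) *
        (ξ ^ i.1 * (ξ • (1 : Matrix (Fin m) (Fin m) ℂ) - M.1)⁻¹ a c)) (sphere 0 r) := by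
    intro ξ _
    have : ∀ η : ℂ, monom i (ξ, η) * ((ξ • (1 : Matrix (Fin m) (Fin m) ℂ) - M.1)⁻¹ *
        (η • (1 : Matrix (Fin m) (Fin m) ℂ) - M.2)⁻¹) a b =
        ∑ c, (ξ ^ i.1 * (ξ • (1 : Matrix (Fin m) (Fin m) ℂ) - M.1)⁻¹ a c) *
          (η ^ i.2 * (η • (1 : Matrix (Fin m) (Fin m) ℂ) - M.2)⁻¹ c b) := by
      intro η
      rw [Matrix.mul_apply, Finset.mul_sum]
      exact Finset.sum_congr rfl fun c _ => by rw [monom]; ring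
    simp only [this]
    rw [circleIntegral.integral_fun_sum]
    · refine Finset.sum_congr rfl fun c _ => ?_
      rw [circleIntegral.integral_const_mul, circleIntegral_pow_resolvent h.pos h.det_snd, mul_comm]
    · intro c _
      refine ContinuousOn.circleIntegrable h.pos.le fun η hη => ?_
      have hη : ‖η‖ = r := by simpa using hη
      exact (continuousAt_const.mul ((continuousAt_id.pow i.2).mul
        (differentiableAt_resolvent (h.det_snd η hη.ge) c b).continuousAt)).continuousWithinAt
  rw [cauchyEval, Matrix.of_apply, circleIntegral.integral_congr h.pos.le hinner,
    circleIntegral.integral_fun_sum]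
  · simp only [circleIntegral.integral_const_mul, circleIntegral_pow_resolvent h.pos h.det_fst]
    rw [Matrix.mul_apply, Finset.mul_sum]
    refine Finset.sum_congr rfl fun c _ => ?_
    have hπ : (Real.pi : ℂ) ≠ 0 := by exact_mod_cast Real.pi_ne_zero
    have hI := Complex.I_ne_zero
    field_simp
  · intro c _
    refine ContinuousOn.circleIntegrable h.pos.le fun ξ hξ => ?_
    have hξ : ‖ξ‖ = r := by simpa using hξ
    exact (continuousAt_const.mul ((continuousAt_id.pow i.1).mul
      (differentiableAt_resolvent (h.det_fst ξ hξ.ge) a c).continuousAt)).continuousWithinAt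

theorem Encircles.cauchyEval_poly (h : Encircles r M) (s : Finset (ℕ × ℕ)) (a : ℕ × ℕ → ℂ) :
    cauchyEval r (poly s a) M = ∑ i ∈ s, a i • (M.1 ^ i.1 * M.2 ^ i.2) := by
  simp only [← h.cauchyEval_monom]
  exact h.cauchyEval_sum s a fun i _ => (differentiable_monom i).continuous.continuousOn

theorem Encircles.cauchyEval_poly_mul (h : Encircles r M) (s t : Finset (ℕ × ℕ))
    (a b : ℕ × ℕ → ℂ) : cauchyEval r (fun z => poly s a z * poly t b z) M =
      cauchyEval r (poly s a) M * cauchyEval r (poly t b) M := by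
  have h1 : (fun z => poly s a z * poly t b z) = fun z =>
      ∑ q ∈ s ×ˢ t, (a q.1 * b q.2) * monom (q.1 + q.2) z := by
    ext z
    simp only [poly, Finset.sum_mul_sum, ← Finset.sum_product', monom, Prod.fst_add, Prod.snd_add,
      pow_add]
    exact Finset.sum_congr rfl fun q _ => by ring
  rw [h1, h.cauchyEval_sum _ _ fun i _ => (differentiable_monom _).continuous.continuousOn,
    h.cauchyEval_poly, h.cauchyEval_poly, Finset.sum_mul_sum, ← Finset.sum_product']
  refine Finset.sum_congr rfl fun q _ => ?_
  rw [h.cauchyEval_monom, smul_mul_smul_comm, Prod.fst_add, Prod.snd_add, pow_add, pow_add]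
  congr 1
  -- The only place where multiplicativity needs the two matrices to commute.
  have hc : Commute (M.1 ^ q.2.1) (M.2 ^ q.1.2) := h.comm.pow_pow _ _
  simp only [mul_assoc]
  congr 1
  simp only [← mul_assoc]
  rw [hc.eq]

theorem Encircles.exists_poly_tendsto (h : Encircles r M) {φ : ℂ × ℂ → ℂ}
    (hφ : DifferentiableOn ℂ φ bidisc) : ∃ (s : ℕ → Finset (ℕ × ℕ)) (a : ℕ → ℕ × ℕ → ℂ) (C : ℝ),
      (∀ᶠ N in atTop, ∀ z ∈ torus r, ‖poly (s N) (a N) z‖ ≤ C) ∧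
      ∀ z ∈ torus r, Tendsto (fun N => poly (s N) (a N) z) atTop (𝓝 (φ z)) := by
  obtain ⟨s, a, hlim⟩ := exists_poly_approx hφ h.pos h.lt_one
  obtain ⟨C, -, hC⟩ := exists_norm_le_torus (h.continuousOn hφ)
  refine ⟨s, a, C + 1, ?_, fun z hz => hlim.tendsto_at hz⟩
  filter_upwards [Metric.tendstoUniformlyOn_iff.mp hlim 1 one_pos] with N hN z hz
  have h1 := hN z hz
  rw [dist_eq_norm] at h1
  have h2 := norm_sub_norm_le (poly (s N) (a N) z) (φ z)
  rw [norm_sub_rev] at h2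
  linarith [hC z hz]

/-- The Cauchy functional calculus is multiplicative. -/
theorem Encircles.cauchyEval_mul (h : Encircles r M) {φ ψ : ℂ × ℂ → ℂ}
    (hφ : DifferentiableOn ℂ φ bidisc) (hψ : DifferentiableOn ℂ ψ bidisc) :
    cauchyEval r (fun z => φ z * ψ z) M = cauchyEval r φ M * cauchyEval r ψ M := by
  obtain ⟨s, a, C, hC, hlim⟩ := h.exists_poly_tendsto hφ
  obtain ⟨t, b, D, hD, hlim'⟩ := h.exists_poly_tendsto hψ
  have hp : ∀ (s : Finset (ℕ × ℕ)) (a : ℕ × ℕ → ℂ), ContinuousOn (poly s a) (torus r) :=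
    fun s a => (differentiable_poly s a).continuous.continuousOn
  have h1 := h.tendsto_cauchyEval (fun n => hp _ _) (h.continuousOn hφ) hC hlim
  have h2 := h.tendsto_cauchyEval (fun n => hp _ _) (h.continuousOn hψ) hD hlim'
  have h3 := h.tendsto_cauchyEval (C := C * D) (fun n => (hp (s n) (a n)).mul (hp (t n) (b n)))
    ((h.continuousOn hφ).mul (h.continuousOn hψ)) (by
      filter_upwards [hC, hD] with n h1 h2 z hz
      rw [Pi.mul_apply, norm_mul]
      exact mul_le_mul (h1 z hz) (h2 z hz) (norm_nonneg _) ((norm_nonneg _).trans (h1 z hz)))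
    (fun z hz => (hlim z hz).mul (hlim' z hz))
  refine tendsto_nhds_unique h3 ((h1.mul h2).congr fun n => ?_)
  exact (h.cauchyEval_poly_mul _ _ _ _).symm

theorem Encircles.cauchyEval_const (h : Encircles r M) (c : ℂ) :
    cauchyEval r (fun _ => c) M = c • (1 : Matrix (Fin m) (Fin m) ℂ) := by
  have h1 := h.cauchyEval_poly {(0, 0)} fun _ => c
  have h2 : poly {(0, 0)} (fun _ => c) = fun _ => c := by
    ext z; simp [poly, monom]
  rw [h2] at h1
  simpa using h1

theorem Encircles.cauchyEval_comp (h : Encircles r M) {F : ℂ → ℂ}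
    (hF : DifferentiableOn ℂ F (ball 0 1)) {f : ℂ × ℂ → ℂ} (hf : DifferentiableOn ℂ f bidisc)
    (hmaps : Set.MapsTo f bidisc (ball 0 1)) {c : ℂ} (hc : c ∈ ball (0 : ℂ) 1)
    (hfc : cauchyEval r f M = c • (1 : Matrix (Fin m) (Fin m) ℂ)) :
    cauchyEval r (fun z => F (f z)) M = F c • (1 : Matrix (Fin m) (Fin m) ℂ) := by
  have hG : DifferentiableOn ℂ (dslope F c) (ball 0 1) :=
    (Complex.differentiableOn_dslope (isOpen_ball.mem_nhds hc)).mpr hF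
  have hGf : DifferentiableOn ℂ (fun z => dslope F c (f z)) bidisc := hG.comp hf hmaps
  have hsub : DifferentiableOn ℂ (fun z => f z + (-c)) bidisc := hf.add_const _
  -- Divided difference at `c`: the factor `f - c` evaluates to 0 at `M`, so by multiplicativity
  -- only `F c` survives.
  have h1 : (fun z => F (f z)) = fun z => F c + (f z + (-c)) * dslope F c (f z) := by
    ext z
    have := sub_smul_dslope F c (f z)
    rw [smul_eq_mul] at this
    rw [← sub_eq_add_neg, this]
    ring
  have h2 : DifferentiableOn ℂ (fun z => (f z + (-c)) * dslope F c (f z)) bidisc := hsub.mul hGf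
  rw [h1, h.cauchyEval_add continuousOn_const (h.continuousOn h2),
    h.cauchyEval_mul hsub hGf, h.cauchyEval_add (h.continuousOn hf) continuousOn_const,
    h.cauchyEval_const, h.cauchyEval_const, hfc, ← add_smul]
  simp

end Calculus

/-! ### Absolutely bounded series of holomorphic functions -/

section Series

theorem mem_bidisc_iff {z : ℂ × ℂ} : z ∈ bidisc ↔ ‖z‖ < 1 := by
  simp [bidisc, Prod.norm_def]

/-- A series of holomorphic functions on the bidisc whose absolute partial sums are bounded
satisfies the Weierstrass criterion on smaller bidiscs. -/
theorem exists_summable_bound {G : ℕ → ℂ × ℂ → ℂ} (hG : ∀ n, DifferentiableOn ℂ (G n) bidisc)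
    {C : ℝ} (hC : ∀ N, ∀ z ∈ bidisc, ∑ n ∈ Finset.range N, ‖G n z‖ ≤ C) {ρ : ℝ} (hρ0 : 0 < ρ)
    (hρ : ρ < 1) : ∃ u : ℕ → ℝ, Summable u ∧ ∀ n z, ‖z‖ ≤ ρ → ‖G n z‖ ≤ u n := by
  obtain ⟨R, hρR, hR1⟩ := exists_between hρ
  have hR : 0 < R := hρ0.trans hρR
  have hcont : ∀ n, Continuous fun p => G n (torusPt R p) := fun n =>
    continuous_comp_torusPt hR.le ((hG n).continuousOn.mono (torus_subset_bidisc hR1))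
  have hint : ∀ n, Integrable (fun p => ‖G n (torusPt R p)‖) angles := fun n =>
    (integrable_angles (hcont n)).norm
  -- The pointwise bound on the absolute partial sums makes the `L¹` norms over the torus summable;
  -- Cauchy's formula turns these into sup bounds on the smaller bidisc.
  have hsum : Summable fun n => ∫ p, ‖G n (torusPt R p)‖ ∂angles := by
    refine summable_of_sum_range_le (c := C * angles.real Set.univ)
      (fun n => integral_nonneg fun p => norm_nonneg _) fun N => ?_
    rw [← integral_finsetSum _ fun n _ => hint n]
    calc _ ≤ ∫ _, C ∂angles := integral_mono (integrable_finsetSum _ fun n _ => hint n)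
          (integrable_const _) fun p => hC N _ (torus_subset_bidisc hR1 (torusPt_mem hR.le p))
      _ = _ := by simp [mul_comm]
  set K : ℝ := ‖(4 * (Real.pi : ℂ) ^ 2)⁻¹‖ * (R / (R - ρ)) ^ 2 with hK
  refine ⟨fun n => K * ∫ p, ‖G n (torusPt R p)‖ ∂angles, hsum.mul_left K, fun n z hz => ?_⟩
  have hz1 : ‖z.1‖ ≤ ρ := (norm_fst_le z).trans hz
  have hz2 : ‖z.2‖ ≤ ρ := (norm_snd_le z).trans hz
  rw [cauchy_formula (hG n) hR hR1 (hz1.trans_lt hρR) (hz2.trans_lt hρR)]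
  beta_reduce
  rw [← integral_const_mul K]
  refine norm_integral_le_of_norm_le ((hint n).const_mul K) (Eventually.of_forall fun p => ?_)
  have h1 := norm_cauchyKer_le hρR (norm_torusPt_fst hR.le p) hz1
  have h2 := norm_cauchyKer_le hρR (norm_torusPt_snd hR.le p) hz2
  rw [norm_mul, norm_mul, norm_mul, hK, mul_assoc]
  refine mul_le_mul_of_nonneg_left ?_ (norm_nonneg _)
  rw [mul_comm, sq]
  gcongr

theorem differentiableOn_tsum_bidisc {G : ℕ → ℂ × ℂ → ℂ}
    (hG : ∀ n, DifferentiableOn ℂ (G n) bidisc) {C : ℝ}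
    (hC : ∀ N, ∀ z ∈ bidisc, ∑ n ∈ Finset.range N, ‖G n z‖ ≤ C) :
    DifferentiableOn ℂ (fun z => ∑' n, G n z) bidisc := by
  intro z hz
  obtain ⟨ρ, hzρ, hρ1⟩ := exists_between (mem_bidisc_iff.mp hz)
  obtain ⟨ρ', hρ, hρ1'⟩ := exists_between hρ1
  have hρ0 : 0 < ρ := (norm_nonneg z).trans_lt hzρ
  have hd : 0 < ρ' - ρ := sub_pos.mpr hρ
  obtain ⟨u, hu, hbound⟩ := exists_summable_bound hG hC (hρ0.trans hρ) hρ1'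
  have hsub : ∀ x ∈ ball (0 : ℂ × ℂ) ρ, ball x (ρ' - ρ) ⊆ ball 0 ρ' := fun x hx =>
    ball_subset_ball' (by rw [mem_ball] at hx; linarith)
  have hsub' : ball (0 : ℂ × ℂ) ρ' ⊆ bidisc := fun x hx =>
    mem_bidisc_iff.mpr ((mem_ball_zero_iff.mp hx).trans hρ1')
  refine (hasFDerivAt_tsum_of_isPreconnected (u := fun n => 2 * u n / (ρ' - ρ))
    (f' := fun n => fderiv ℂ (G n)) ((hu.mul_left 2).div_const _) (isOpen_ball (x := 0) (ε := ρ))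
    (convex_ball (0 : ℂ × ℂ) ρ).isPreconnected (fun n x hx => ?_) (fun n x hx => ?_)
    (mem_ball_self hρ0) ?_ (mem_ball_zero_iff.mpr hzρ)).differentiableAt.differentiableWithinAt
  · exact ((hG n).differentiableAt (isOpen_bidisc.mem_nhds
      (hsub' (ball_subset_ball hρ.le hx)))).hasFDerivAt
  -- Cauchy estimate on a ball of radius `ρ' - ρ`, where `G n` differs from its central value by at
  -- most `2 * u n`.
  · refine Complex.norm_fderiv_le_div_of_mapsTo_ball
      ((hG n).mono ((hsub x hx).trans hsub')) (fun y hy => ?_) hd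
    have h1 := hbound n x (mem_ball_zero_iff.mp (ball_subset_ball hρ.le hx)).le
    have h2 := hbound n y (mem_ball_zero_iff.mp (hsub x hx hy)).le
    rw [mem_closedBall, dist_eq_norm]
    linarith [norm_sub_le (G n y) (G n x)]
  · exact hu.of_norm_bounded fun n => hbound n 0 (by simpa using (hρ0.trans hρ).le)

/-- The sum of such a series is bounded and holomorphic, and it may be evaluated term by term. -/
theorem exists_sum_series {G : ℕ → ℂ × ℂ → ℂ} (hG : ∀ n, DifferentiableOn ℂ (G n) bidisc) {C : ℝ}
    (hC : ∀ N, ∀ z ∈ bidisc, ∑ n ∈ Finset.range N, ‖G n z‖ ≤ C) :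
    ∃ φ ∈ Hinf, ∀ (r : ℝ) (m : ℕ) (M : MatPair m), Encircles r M →
      Tendsto (fun N => ∑ n ∈ Finset.range N, cauchyEval r (G n) M) atTop
        (𝓝 (cauchyEval r φ M)) := by
  have hsum : ∀ z ∈ bidisc, Summable fun n => ‖G n z‖ := fun z hz =>
    summable_of_sum_range_le (fun n => norm_nonneg _) fun N => hC N z hz
  have hdiff := differentiableOn_tsum_bidisc hG hC
  refine ⟨fun z => ∑' n, G n z, ⟨hdiff, C, fun z hz => ?_⟩, fun r m M h => ?_⟩
  · exact (norm_tsum_le_tsum_norm (hsum z hz)).trans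
      (Real.tsum_le_of_sum_range_le (fun n => norm_nonneg _) fun N => hC N z hz)
  · have hc : ∀ n, ContinuousOn (G n) (torus r) := fun n => h.continuousOn (hG n)
    have := h.tendsto_cauchyEval (φ := fun N z => ∑ n ∈ Finset.range N, 1 * G n z) (C := C)
      (fun N => continuousOn_finsetSum _ fun n _ => continuousOn_const.mul (hc n))
      (h.continuousOn hdiff) (Eventually.of_forall fun N z hz => ?_) (fun z hz => ?_)
    · refine this.congr fun N => ?_
      rw [h.cauchyEval_sum _ _ fun n _ => hc n]
      simp
    · simp only [one_mul]
      exact (norm_sum_le _ _).trans (hC N z (torus_subset_bidisc h.lt_one hz))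
    · simp only [one_mul]
      exact (hsum z (torus_subset_bidisc h.lt_one hz)).of_norm.hasSum.tendsto_sum_nat

end Series

/-! ### The bump and damping functions on the disc -/

section Disc

/-- A function on the disc with positive real part, equal to `ε` at the origin. -/
noncomputable def herglotz (ε : ℝ) (w : ℂ) : ℂ := ε * ((1 + w) / (1 - w))

/-- A function on the disc that vanishes at the origin and is dominated by the real part of
`herglotz ε` where `‖w‖ ≤ 1 - ε`. -/
noncomputable def bump (ε : ℝ) (w : ℂ) : ℂ := ε ^ 2 * (w / (1 - w) ^ 2)

/-- The damping factor `exp (-herglotz ε)`. -/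
noncomputable def damp (ε : ℝ) (w : ℂ) : ℂ := Complex.exp (-herglotz ε w)

theorem one_sub_ne_zero_of_mem_ball {w : ℂ} (hw : w ∈ ball (0 : ℂ) 1) : 1 - w ≠ 0 :=
  sub_ne_zero_of_norm_lt (by simpa using hw)

theorem differentiableOn_bump (ε : ℝ) : DifferentiableOn ℂ (bump ε) (ball 0 1) := fun w hw => by
  have := pow_ne_zero 2 (one_sub_ne_zero_of_mem_ball hw)
  unfold bump
  fun_prop (disch := assumption)

theorem differentiableOn_damp (ε : ℝ) : DifferentiableOn ℂ (damp ε) (ball 0 1) := fun w hw => by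
  have := one_sub_ne_zero_of_mem_ball hw
  unfold damp herglotz
  fun_prop (disch := assumption)

theorem herglotz_re (ε : ℝ) (w : ℂ) :
    (herglotz ε w).re = ε * ((1 - ‖w‖ ^ 2) / ‖1 - w‖ ^ 2) := by
  rw [herglotz, Complex.re_ofReal_mul, Complex.div_re, ← add_div, ← Complex.normSq_eq_norm_sq,
    ← Complex.normSq_eq_norm_sq, Complex.normSq_apply w]
  congr 2
  simp only [Complex.add_re, Complex.sub_re, Complex.add_im, Complex.sub_im, Complex.one_re,
    Complex.one_im]
  ring

theorem norm_damp (ε : ℝ) (w : ℂ) :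
    ‖damp ε w‖ = Real.exp (-(ε * ((1 - ‖w‖ ^ 2) / ‖1 - w‖ ^ 2))) := by
  rw [damp, Complex.norm_exp, Complex.neg_re, herglotz_re]

theorem norm_bump {ε : ℝ} (hε : 0 ≤ ε) (w : ℂ) : ‖bump ε w‖ = ε ^ 2 * (‖w‖ / ‖1 - w‖ ^ 2) := by
  rw [bump, norm_mul, norm_div, norm_pow, norm_pow, Complex.norm_real, Real.norm_of_nonneg hε]

theorem norm_bump_mul_norm_damp_le {ε : ℝ} (h0 : 0 ≤ ε) {w : ℂ}
    (hw : ‖w‖ ≤ 1 - ε) : ‖bump ε w‖ * ‖damp ε w‖ ≤ 1 - ‖damp ε w‖ := by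
  rw [norm_damp]
  set a := ε * ((1 - ‖w‖ ^ 2) / ‖1 - w‖ ^ 2) with ha
  -- With `a = Re herglotz`, it suffices that `|bump| ≤ a`, since `a e⁻ᵃ ≤ 1 - e⁻ᵃ` follows from `1
  -- + a ≤ eᵃ`.
  have h1 : ‖bump ε w‖ ≤ a := by
    have h2 : ε * ‖w‖ ≤ 1 - ‖w‖ ^ 2 := by nlinarith [norm_nonneg w]
    rw [norm_bump h0, ha, sq, mul_assoc, ← mul_div_assoc]
    gcongr
  have h3 := Real.add_one_le_exp a
  have h4 : Real.exp a * Real.exp (-a) = 1 := by rw [← Real.exp_add]; simp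
  nlinarith [Real.exp_pos (-a)]

theorem norm_damp_zero (ε : ℝ) : ‖damp ε 0‖ = Real.exp (-ε) := by
  simp [norm_damp]

/-- At `c = (1 - ε)²` one has `1 - c = ε (2 - ε)`, so the exponent `ε (1 + c) / (1 - c)` equals `(1
+ c) / (2 - ε) ≤ 2`, uniformly in `ε`. -/
theorem exp_neg_two_le_norm_damp {ε : ℝ} (h0 : 0 < ε) (h1 : ε < 1) :
    Real.exp (-2) ≤ ‖damp ε (((1 - ε) ^ 2 : ℝ) : ℂ)‖ := by
  have hc : (0 : ℝ) ≤ (1 - ε) ^ 2 := sq_nonneg _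
  have h2 : (1 : ℂ) - (((1 - ε) ^ 2 : ℝ) : ℂ) = ((ε * (2 - ε) : ℝ) : ℂ) := by push_cast; ring
  have h3 : 0 < ε * (2 - ε) := mul_pos h0 (by linarith)
  rw [norm_damp, h2, Complex.norm_real, Complex.norm_real, Real.norm_of_nonneg hc,
    Real.norm_of_nonneg h3.le]
  refine Real.exp_le_exp.mpr (neg_le_neg ?_)
  rw [← mul_div_assoc, div_le_iff₀ (by positivity)]
  have h4 : 1 - ((1 - ε) ^ 2) ^ 2 = (ε * (2 - ε)) * (1 + (1 - ε) ^ 2) := by ring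
  rw [h4]
  have h5 : ε * (1 + (1 - ε) ^ 2) ≤ 2 * (ε * (2 - ε)) := by nlinarith
  nlinarith

/-- The factor `ε²` in `bump` cancels the one in `(1 - c)² = ε² (2 - ε)²`, leaving a bound that does
not degenerate as `ε → 0`. -/
theorem le_norm_bump {ε : ℝ} (h0 : 0 < ε) (h1 : ε < 1) :
    (1 - ε) ^ 2 / 4 ≤ ‖bump ε (((1 - ε) ^ 2 : ℝ) : ℂ)‖ := by
  have hc : (0 : ℝ) ≤ (1 - ε) ^ 2 := sq_nonneg _
  have h2 : (1 : ℂ) - (((1 - ε) ^ 2 : ℝ) : ℂ) = ((ε * (2 - ε) : ℝ) : ℂ) := by push_cast; ring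
  have h3 : 0 < ε * (2 - ε) := mul_pos h0 (by linarith)
  rw [norm_bump h0.le, h2, Complex.norm_real, Complex.norm_real, Real.norm_of_nonneg hc,
    Real.norm_of_nonneg h3.le, ← mul_div_assoc, mul_pow, mul_div_mul_left _ _ (by positivity)]
  have h4 : (0 : ℝ) < 2 - ε := by linarith
  gcongr
  nlinarith

end Disc

/-! ### Telescoping products of damping factors -/

section Damping

variable {ε : ℕ → ℝ} {f : ℕ → ℂ × ℂ → ℂ}

/-- The product of the first `n` damping factors. -/
noncomputable def dampProd (ε : ℕ → ℝ) (f : ℕ → ℂ × ℂ → ℂ) (n : ℕ) (z : ℂ × ℂ) : ℂ :=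
  ∏ k ∈ Finset.range n, damp (ε k) (f k z)

theorem dampProd_succ (n : ℕ) :
    dampProd ε f (n + 1) = fun z => dampProd ε f n z * damp (ε n) (f n z) := by
  ext z
  exact Finset.prod_range_succ _ _

theorem differentiableOn_dampProd (hf : ∀ n, DifferentiableOn ℂ (f n) bidisc)
    (hmaps : ∀ n, Set.MapsTo (f n) bidisc (ball 0 1)) (n : ℕ) :
    DifferentiableOn ℂ (dampProd ε f n) bidisc := by
  induction n with
  | zero =>
    have : dampProd ε f 0 = fun _ => 1 := by ext z; simp [dampProd]
    rw [this]
    exact differentiableOn_const 1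
  | succ n ih =>
    rw [dampProd_succ]
    exact ih.mul ((differentiableOn_damp (ε n)).comp (hf n) (hmaps n))

/-- Each term is at most `|P n| (1 - |damp|) = |P n| - |P (n + 1)|`, where `P n` is the product of
the first `n` factors. -/
theorem sum_norm_bump_mul_dampProd_le (hε : ∀ n, 0 ≤ ε n) {z : ℂ × ℂ}
    (hf : ∀ n, ‖f n z‖ ≤ 1 - ε n) (N : ℕ) :
    ∑ n ∈ Finset.range N, ‖bump (ε n) (f n z) * dampProd ε f (n + 1) z‖ ≤
      1 - ‖dampProd ε f N z‖ := by
  induction N with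
  | zero => simp [dampProd]
  | succ N ih =>
    rw [Finset.sum_range_succ, dampProd_succ]
    simp only [norm_mul]
    have h1 := norm_bump_mul_norm_damp_le (hε N) (hf N)
    have h2 := norm_nonneg (dampProd ε f N z)
    simp only [norm_mul] at ih
    nlinarith

theorem Encircles.cauchyEval_dampProd {m : ℕ} {r : ℝ} {M : MatPair m} (h : Encircles r M)
    (hf : ∀ n, DifferentiableOn ℂ (f n) bidisc)
    (hmaps : ∀ n, Set.MapsTo (f n) bidisc (ball 0 1)) {c : ℕ → ℂ}
    (hc : ∀ n, c n ∈ ball (0 : ℂ) 1)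
    (hfc : ∀ n, cauchyEval r (f n) M = c n • (1 : Matrix (Fin m) (Fin m) ℂ)) (n : ℕ) :
    cauchyEval r (dampProd ε f n) M =
      (∏ k ∈ Finset.range n, damp (ε k) (c k)) • (1 : Matrix (Fin m) (Fin m) ℂ) := by
  induction n with
  | zero =>
    have : dampProd ε f 0 = fun _ => 1 := by ext z; simp [dampProd]
    rw [this, h.cauchyEval_const]
    simp
  | succ n ih =>
    have hd : DifferentiableOn ℂ (fun z => damp (ε n) (f n z)) bidisc :=
      (differentiableOn_damp (ε n)).comp (hf n) (hmaps n)
    rw [dampProd_succ, h.cauchyEval_mul (differentiableOn_dampProd hf hmaps n) hd, ih,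
      h.cauchyEval_comp (differentiableOn_damp (ε n)) (hf n) (hmaps n) (hc n) (hfc n),
      Finset.prod_range_succ, smul_mul_smul_comm, one_mul]

end Damping

/-! ### Interpolation from a separating family -/

section Interpolation

variable {s : ℕ → ℕ} {A : ∀ n, MatPair (s n)}

/-- A family of functions `f n` that are uniformly small off the identity at `A n`, in a summable
way, and vanish at the other points yields interpolation. -/
theorem isInterpolating_of_separating (hA : ∀ n, Encircles (evalRadius (A n)) (A n)) {ε : ℕ → ℝ}
    (h0 : ∀ n, 0 < ε n) {t : ℝ} (ht : 0 < t) (h1 : ∀ n, t ≤ 1 - ε n) {B : ℝ}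
    (hB : ∀ N, ∑ n ∈ Finset.range N, ε n ≤ B) {f : ℕ → ℂ × ℂ → ℂ}
    (hf : ∀ n, DifferentiableOn ℂ (f n) bidisc) (hbd : ∀ n, ∀ z ∈ bidisc, ‖f n z‖ ≤ 1 - ε n)
    (hone : ∀ n, eval (f n) (A n) =
      (((1 - ε n) ^ 2 : ℝ) : ℂ) • (1 : Matrix (Fin (s n)) (Fin (s n)) ℂ))
    (hzero : ∀ n j, j ≠ n → eval (f n) (A j) = 0) : IsInterpolating A := by
  rintro ψ hψ ⟨D, hD⟩
  have h1' : ∀ n, ε n < 1 := fun n => by linarith [h1 n]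
  have hmaps : ∀ n, Set.MapsTo (f n) bidisc (ball 0 1) := fun n z hz =>
    mem_ball_zero_iff.mpr ((hbd n z hz).trans_lt (by linarith [h0 n]))
  let c : ℕ → ℕ → ℂ := fun j n => if n = j then (((1 - ε n) ^ 2 : ℝ) : ℂ) else 0
  have hcb : ∀ j n, c j n ∈ ball (0 : ℂ) 1 := by
    intro j n
    by_cases h : n = j
    · simp only [c, h, if_true, mem_ball_zero_iff, Complex.norm_real,
        Real.norm_of_nonneg (sq_nonneg (1 - ε j))]
      nlinarith [h0 j, h1' j]
    · simp [c, h]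
  have hfc : ∀ j n, eval (f n) (A j) = c j n • (1 : Matrix (Fin (s j)) (Fin (s j)) ℂ) := by
    intro j n
    by_cases h : n = j
    · subst h
      simpa [c] using hone n
    · simpa [c, h] using hzero n j (Ne.symm h)
  -- The scalar by which `b n` acts at `A n`. Factors with `k < n` are `exp (-ε k)`, with product at
  -- least `exp (-B)`; the factor `k = n` is at least `exp (-2)`, and the bump at least `t² / 4`.
  let κ : ℕ → ℂ := fun n => bump (ε n) (c n n) * ∏ k ∈ Finset.range (n + 1), damp (ε k) (c n k)
  set q : ℝ := t ^ 2 / 4 * (Real.exp (-B) * Real.exp (-2)) with hq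
  have hq0 : 0 < q := by positivity
  have hκ : ∀ n, q ≤ ‖κ n‖ := by
    intro n
    have hcn : c n n = (((1 - ε n) ^ 2 : ℝ) : ℂ) := by simp [c]
    have hck : ∀ k ∈ Finset.range n, ‖damp (ε k) (c n k)‖ = Real.exp (-ε k) := fun k hk => by
      have : k ≠ n := (Finset.mem_range.mp hk).ne
      simp [c, this, norm_damp_zero]
    simp only [κ]
    rw [norm_mul, Finset.prod_range_succ, norm_mul, norm_prod, Finset.prod_congr rfl hck,
      ← Real.exp_sum, Finset.sum_neg_distrib, hcn, hq]
    have h2 := exp_neg_two_le_norm_damp (h0 n) (h1' n)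
    have h3 : t ^ 2 / 4 ≤ ‖bump (ε n) (((1 - ε n) ^ 2 : ℝ) : ℂ)‖ :=
      le_trans (by gcongr; exact h1 n) (le_norm_bump (h0 n) (h1' n))
    have h4 := hB n
    gcongr
  have hκ0 : ∀ n, κ n ≠ 0 := fun n => norm_pos_iff.mp (hq0.trans_le (hκ n))
  let b : ℕ → ℂ × ℂ → ℂ := fun n z => bump (ε n) (f n z) * dampProd ε f (n + 1) z
  have hbumpd : ∀ n, DifferentiableOn ℂ (fun z => bump (ε n) (f n z)) bidisc := fun n =>
    (differentiableOn_bump (ε n)).comp (hf n) (hmaps n)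
  have hbd' : ∀ n, DifferentiableOn ℂ (b n) bidisc := fun n =>
    (hbumpd n).mul (differentiableOn_dampProd hf hmaps (n + 1))
  have hbeval : ∀ j n, eval (b n) (A j) = (bump (ε n) (c j n) *
      ∏ k ∈ Finset.range (n + 1), damp (ε k) (c j k)) •
        (1 : Matrix (Fin (s j)) (Fin (s j)) ℂ) := by
    intro j n
    rw [eval, (hA j).cauchyEval_mul (hbumpd n) (differentiableOn_dampProd hf hmaps (n + 1)),
      (hA j).cauchyEval_dampProd hf hmaps (hcb j) (hfc j),
      (hA j).cauchyEval_comp (differentiableOn_bump (ε n)) (hf n) (hmaps n) (hcb j n) (hfc j n),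
      smul_mul_smul_comm, one_mul]
  let G : ℕ → ℂ × ℂ → ℂ := fun n z => (κ n)⁻¹ * (b n z * ψ n z)
  have hbψ : ∀ n, DifferentiableOn ℂ (fun z => b n z * ψ n z) bidisc := fun n =>
    (hbd' n).mul (hψ n).1
  have hG : ∀ n, DifferentiableOn ℂ (G n) bidisc := fun n => (hbψ n).const_mul _
  have hGeval : ∀ j n, eval (G n) (A j) = if n = j then eval (ψ j) (A j) else 0 := by
    intro j n
    have h2 : eval (G n) (A j) = (κ n)⁻¹ • (eval (b n) (A j) * eval (ψ n) (A j)) := by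
      rw [eval, (hA j).cauchyEval_const_mul _ ((hA j).continuousOn (hbψ n)),
        (hA j).cauchyEval_mul (hbd' n) (hψ n).1]
      rfl
    rw [h2, hbeval]
    by_cases h : n = j
    · subst h
      rw [if_pos rfl, smul_mul_assoc, one_mul, smul_smul, inv_mul_cancel₀ (hκ0 n), one_smul]
    · simp [h, c, bump]
  have hGsum : ∀ N, ∀ z ∈ bidisc, ∑ n ∈ Finset.range N, ‖G n z‖ ≤ q⁻¹ * D := by
    intro N z hz
    have hD0 : 0 ≤ D := (norm_nonneg _).trans (hD 0 z hz)
    calc ∑ n ∈ Finset.range N, ‖G n z‖ ≤ ∑ n ∈ Finset.range N, q⁻¹ * D * ‖b n z‖ := by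
          refine Finset.sum_le_sum fun n _ => ?_
          simp only [G]
          rw [norm_mul, norm_mul, norm_inv, mul_comm ‖b n z‖, ← mul_assoc]
          have h2 := hκ n
          have h3 := hD n z hz
          gcongr
      _ = q⁻¹ * D * ∑ n ∈ Finset.range N, ‖b n z‖ := by rw [Finset.mul_sum]
      _ ≤ q⁻¹ * D * 1 := by
          have h2 := sum_norm_bump_mul_dampProd_le (fun n => (h0 n).le) (fun n => hbd n z hz) N
          have h3 := norm_nonneg (dampProd ε f N z)
          gcongr
          linarith
      _ = q⁻¹ * D := mul_one _
  obtain ⟨φ, hφ, hlim⟩ := exists_sum_series hG hGsum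
  refine ⟨φ, hφ, fun j => tendsto_nhds_unique (hlim _ _ (A j) (hA j)) ?_⟩
  -- The partial sums evaluated at `A j` are constant once `N > j`.
  refine tendsto_const_nhds.congr' ?_
  filter_upwards [eventually_gt_atTop j] with N hN
  refine Eq.trans ?_ (Finset.sum_congr rfl fun n _ => (hGeval j n).symm)
  rw [Finset.sum_ite_eq', if_pos (Finset.mem_range.mpr hN)]

/-! ### Gleason distances and extraction of the separating family -/

theorem norm_le_supNorm_toReal {φ : ℂ × ℂ → ℂ} {C : ℝ≥0∞} (hC : C ≠ ∞) (h : supNorm φ ≤ C)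
    {z : ℂ × ℂ} (hz : z ∈ bidisc) : ‖φ z‖ ≤ C.toReal := by
  have h1 : ‖φ z‖ₑ ≤ C := (le_iSup₂ (f := fun z (_ : z ∈ bidisc) => ‖φ z‖ₑ) z hz).trans h
  simpa using ENNReal.toReal_mono hC h1

/-- If `‖φ‖ < 1`, then `φ ^ k → 0` while `(φ ^ k)(M) = Id` for all `k`, impossible for size `m > 0`.
Hence Gleason distances are at most 1 and their partial products decrease. -/
theorem one_le_supNorm {m : ℕ} (hm : 0 < m) {M : MatPair m} (hM : Encircles (evalRadius M) M)
    {φ : ℂ × ℂ → ℂ} (hφ : DifferentiableOn ℂ φ bidisc) (h1 : eval φ M = 1) : 1 ≤ supNorm φ := by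
  by_contra! hlt
  have hne : supNorm φ ≠ ∞ := hlt.ne_top
  set c := (supNorm φ).toReal with hc
  have hc1 : c < 1 := by
    have := (ENNReal.toReal_lt_toReal hne ENNReal.one_ne_top).mpr hlt
    simpa using this
  have hbound : ∀ z ∈ bidisc, ‖φ z‖ ≤ c := fun z hz => norm_le_supNorm_toReal hne le_rfl hz
  have hpow : ∀ k : ℕ, cauchyEval (evalRadius M) (fun z => φ z ^ k) M = 1 := by
    intro k
    induction k with
    | zero => simpa using hM.cauchyEval_const 1
    | succ k ih =>
      simp only [pow_succ]
      rw [hM.cauchyEval_mul (hφ.fun_pow k) hφ, ih, one_mul]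
      exact h1
  have hlim := hM.tendsto_cauchyEval (φ := fun k z => φ z ^ k) (ψ := fun _ => 0) (C := 1)
    (fun k => (hM.continuousOn hφ).pow k) continuousOn_const
    (Eventually.of_forall fun k z hz => by
      rw [norm_pow]
      exact pow_le_one₀ (norm_nonneg _)
        ((hbound z (torus_subset_bidisc hM.lt_one hz)).trans hc1.le))
    (fun z hz => tendsto_pow_atTop_nhds_zero_of_norm_lt_one
      ((hbound z (torus_subset_bidisc hM.lt_one hz)).trans_lt hc1))
  simp only [hpow, hM.cauchyEval_const, zero_smul] at hlim
  have := tendsto_nhds_unique hlim tendsto_const_nhds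
  have : NeZero m := ⟨hm.ne'⟩
  simp_all

theorem gleasonDist_le_one (hs : ∀ n, 0 < s n) (hA : ∀ n, Encircles (evalRadius (A n)) (A n))
    (n : ℕ) (τ : Set ℕ) : gleasonDist A n τ ≤ 1 := by
  rw [gleasonDist, ENNReal.inv_le_one]
  exact le_iInf₂ fun φ hφ => one_le_supNorm (hs n) (hA n) hφ.1.1 hφ.2.1

theorem exists_of_lt_gleasonDist {n : ℕ} {τ : Set ℕ} {t : ℝ} (ht : 0 < t)
    (h : ENNReal.ofReal t < gleasonDist A n τ) : ∃ φ : ℂ × ℂ → ℂ, DifferentiableOn ℂ φ bidisc ∧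
      (∀ z ∈ bidisc, ‖φ z‖ ≤ t⁻¹) ∧ eval φ (A n) = 1 ∧ ∀ j ∈ τ, eval φ (A j) = 0 := by
  rw [gleasonDist, ENNReal.lt_inv_iff_lt_inv] at h
  simp only [iInf_lt_iff] at h
  obtain ⟨φ, ⟨hφ, h1, h2⟩, hlt⟩ := h
  refine ⟨φ, hφ.1, fun z hz => ?_, h1, h2⟩
  rw [← ENNReal.ofReal_inv_of_pos ht] at hlt
  simpa [ENNReal.toReal_ofReal (inv_nonneg.mpr ht.le)] using
    norm_le_supNorm_toReal ENNReal.ofReal_ne_top hlt.le hz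

theorem le_of_tendsto_prod {d : ℕ → ℝ} {p : ℝ} (h0 : ∀ n, 0 ≤ d n) (h1 : ∀ n, d n ≤ 1)
    (hp : Tendsto (fun N => ∏ n ∈ Finset.range N, d n) atTop (𝓝 p)) (N : ℕ) :
    p ≤ ∏ n ∈ Finset.range N, d n := by
  refine Antitone.le_of_tendsto (antitone_nat_of_succ_le fun N => ?_) hp N
  rw [Finset.prod_range_succ]
  exact mul_le_of_le_one_right (Finset.prod_nonneg fun n _ => h0 n) (h1 N)

theorem sum_one_sub_le_neg_log {d : ℕ → ℝ} {p : ℝ} (hp : 0 < p) (h0 : ∀ n, 0 ≤ d n) {N : ℕ}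
    (h : p ≤ ∏ n ∈ Finset.range N, d n) : ∑ n ∈ Finset.range N, (1 - d n) ≤ -Real.log p := by
  have h1 : ∏ n ∈ Finset.range N, d n ≤ Real.exp (-∑ n ∈ Finset.range N, (1 - d n)) := by
    rw [← Finset.sum_neg_distrib, Real.exp_sum]
    refine Finset.prod_le_prod (fun n _ => h0 n) fun n _ => ?_
    have := Real.add_one_le_exp (-(1 - d n))
    linarith
  have h2 := (Real.log_le_iff_le_exp hp).mpr (h.trans h1)
  linarith

end Interpolation

end BidiscMatrix

theorem mainTheorem3 (s : ℕ → ℕ) (hs : ∀ n, 0 < s n)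
    (A : ∀ n, BidiscMatrix.MatPair (s n))
    (hcomm : ∀ n, Commute (A n).1 (A n).2)
    (hspec : ∀ n, BidiscMatrix.jointSpectrum (A n) ⊆ BidiscMatrix.bidisc)
    (hprod : ∃ p : ℝ≥0∞, 0 < p ∧
      Tendsto (fun N : ℕ => ∏ n ∈ Finset.range N, BidiscMatrix.gleasonDist A n {n}ᶜ)
        atTop (𝓝 p)) :
    BidiscMatrix.IsInterpolating A := by
  have hA : ∀ n, BidiscMatrix.Encircles (BidiscMatrix.evalRadius (A n)) (A n) := fun n =>
    BidiscMatrix.encircles_evalRadius (hs n) (hcomm n) (hspec n)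
  obtain ⟨p, hp0, hp⟩ := hprod
  have hle : ∀ n, BidiscMatrix.gleasonDist A n {n}ᶜ ≤ 1 := fun n =>
    BidiscMatrix.gleasonDist_le_one hs hA n _
  have hp1 : p ≤ 1 := le_of_tendsto' hp fun N => Finset.prod_le_one' fun n _ => hle n
  have hptop : p ≠ ∞ := (hp1.trans_lt ENNReal.one_lt_top).ne
  have hdtop : ∀ n, BidiscMatrix.gleasonDist A n {n}ᶜ ≠ ∞ := fun n =>
    ((hle n).trans_lt ENNReal.one_lt_top).ne
  set d : ℕ → ℝ := fun n => (BidiscMatrix.gleasonDist A n {n}ᶜ).toReal with hd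
  set P := p.toReal with hP
  have hP0 : 0 < P := ENNReal.toReal_pos hp0.ne' hptop
  have hd0 : ∀ n, 0 ≤ d n := fun n => ENNReal.toReal_nonneg
  have hd1 : ∀ n, d n ≤ 1 := fun n => by
    simpa using ENNReal.toReal_mono ENNReal.one_ne_top (hle n)
  have hlim : Tendsto (fun N => ∏ n ∈ Finset.range N, d n) atTop (𝓝 P) := by
    have := (ENNReal.tendsto_toReal hptop).comp hp
    simpa only [Function.comp_def, ENNReal.toReal_prod] using this
  have hPle := BidiscMatrix.le_of_tendsto_prod hd0 hd1 hlim
  have hPd : ∀ n, P ≤ d n := fun n => by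
    refine (hPle (n + 1)).trans ?_
    rw [Finset.prod_range_succ]
    exact mul_le_of_le_one_left (hd0 n) (Finset.prod_le_one (fun k _ => hd0 k) fun k _ => hd1 k)
  -- Strictly below `d n`, because the infimum need not be attained; the loss is at most `2⁻ⁿ / 2`,
  -- so `∑ (1 - t n)` grows by at most 1, and `t n ≥ P / 2`.
  let t : ℕ → ℝ := fun n => d n * (1 - (1 / 2) ^ n / 2)
  have hpow : ∀ n : ℕ, 0 < (1 / 2 : ℝ) ^ n ∧ (1 / 2 : ℝ) ^ n ≤ 1 := fun n =>
    ⟨by positivity, pow_le_one₀ (by norm_num) (by norm_num)⟩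
  have htP : ∀ n, P / 2 ≤ t n := fun n => by
    have := hpow n
    have := hPd n
    simp only [t]
    nlinarith
  have ht0 : ∀ n, 0 < t n := fun n => (half_pos hP0).trans_le (htP n)
  have htd : ∀ n, t n < d n := fun n => by
    have := hpow n
    have := hPd n
    simp only [t]
    nlinarith
  have hex : ∀ n, ∃ φ : ℂ × ℂ → ℂ, DifferentiableOn ℂ φ BidiscMatrix.bidisc ∧
      (∀ z ∈ BidiscMatrix.bidisc, ‖φ z‖ ≤ (t n)⁻¹) ∧ BidiscMatrix.eval φ (A n) = 1 ∧
        ∀ j ∈ ({n}ᶜ : Set ℕ), BidiscMatrix.eval φ (A j) = 0 := fun n =>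
    BidiscMatrix.exists_of_lt_gleasonDist (ht0 n)
      ((ENNReal.ofReal_lt_iff_lt_toReal (ht0 n).le (hdtop n)).mpr (htd n))
  choose φ hφ hbd hone hzero using hex
  have hmul : ∀ n j, BidiscMatrix.eval (fun z => (((t n) ^ 2 : ℝ) : ℂ) * φ n z) (A j) =
      (((t n) ^ 2 : ℝ) : ℂ) • BidiscMatrix.eval (φ n) (A j) := fun n j =>
    (hA j).cauchyEval_const_mul _ ((hA j).continuousOn (hφ n))
  -- In `t² φ`, one factor `t` brings the norm down to 1 and the second down to `t = 1 - ε`, the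
  -- room that the bump inequality needs.
  refine BidiscMatrix.isInterpolating_of_separating hA (ε := fun n => 1 - t n)
    (f := fun n z => (((t n) ^ 2 : ℝ) : ℂ) * φ n z) (t := P / 2) (B := -Real.log P + 1)
    (fun n => by linarith [htd n, hd1 n]) (half_pos hP0) (fun n => by linarith [htP n])
    (fun N => ?_) (fun n => (hφ n).const_mul _) (fun n z hz => ?_) (fun n => ?_)
    (fun n j hj => ?_)
  · have h1 := BidiscMatrix.sum_one_sub_le_neg_log hP0 hd0 (hPle N)
    have h2 : ∑ n ∈ Finset.range N, (1 / 2 : ℝ) ^ n ≤ 2 := by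
      rw [geom_sum_eq (by norm_num)]
      rw [div_le_iff_of_neg (by norm_num)]
      linarith [(hpow N).1]
    calc ∑ n ∈ Finset.range N, (1 - t n)
        ≤ ∑ n ∈ Finset.range N, ((1 - d n) + (1 / 2) ^ n / 2) := by
          refine Finset.sum_le_sum fun n _ => ?_
          have := hpow n
          have := hd1 n
          simp only [t]
          nlinarith
      _ ≤ -Real.log P + 1 := by
          rw [Finset.sum_add_distrib, ← Finset.sum_div]
          linarith
  · have h1 := hbd n z hz
    have h2 := ht0 n
    rw [norm_mul, Complex.norm_real, Real.norm_of_nonneg (sq_nonneg _)]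
    calc t n ^ 2 * ‖φ n z‖ ≤ t n ^ 2 * (t n)⁻¹ := by gcongr
      _ = 1 - (1 - t n) := by field_simp; ring
  · rw [hmul, hone, sub_sub_cancel]
  · rw [hmul, hzero n j hj, smul_zero]
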